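/- Let $G$ be a finite group and $n\ge 0$. All $G$-manifolds are compact, smooth, $n$-dimensional, possibly with boundary, with a smooth action. For a $G$-space $X$ let $\mathcal M^G(X)$ be the commutative monoid, under disjoint union, of pairs $(M,f)$ with $M$ a $G$-manifold and $f\colon M\to X$ a continuous $G$-map, up to $G$-diffeomorphism over $X$. An $SK$-operation in $X$ replaces $(M,f)$ by $(M',f')$, where $M=M_1\cup_\varphi M_2$ and $M'=M_1\cup_\psi M_2$ are obtained by gluing the same two $G$-manifolds equivariantly along closed and open parts of their boundaries (so that the cutting hypersurface is disjoint from $\partial M$), and $f|_{M_i}$ and $f'|_{M_i}$ are $G$-homotopic for $i=1,2$. Let $SK^G(X)$ be the quotient of the group completion of $\mathcal M^G(X)$ by the relations $[M,f]=[M',f']$ for all such operations, and let $SK^G=SK^G(\mathrm{pt})$; define $SK^H$ for $H\le G$ in the same way. A span $X\xleftarrow{\alpha}U\xrightarrow{\beta}Y$ of finite $G$-sets induces a (well-defined) homomorphism $(\alpha,\beta)\colon SK^G(X)\to SK^G(Y)$, $[M,f]\mapsto[M\times_XU,\ \beta\circ\mathrm{pr}_U]$. For $K\le H\le G$ let $\pi\colon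 G/K\to G/H$ be the projection. Let $\mathrm{res}^H_K$, $\mathrm{tr}^H_K$ and $c_g$ be the homomorphisms induced by the spans $$G/H\xleftarrow{\pi}G/K\xrightarrow{\mathrm{id}}G/K,\qquad G/K\xleftarrow{\mathrm{id}}G/K\xrightarrow{\pi}G/H,\qquad G/H\xleftarrow{\mathrm{id}}G/H\xrightarrow{\cong}G/gHg^{-1},$$ where the last map is $xH\mapsto xg^{-1}(gHg^{-1})$. For every $H\le G$ there is an isomorphism $SK^G(G/H)\cong SK^H$, $[f\colon M\to G/H]\mapsto[f^{-1}(eH)]$, with inverse $[N]\mapsto[G\times_HN\to G/H]$. The following homomorphisms are well defined, and under these isomorphisms: 1. $\mathrm{res}^H_K$ corresponds to $SK^H\to SK^K$, $[N]\mapsto[N|_K]$, the restriction of the action to $K$; 2. $\mathrm{tr}^H_K$ corresponds to $SK^K\to SK^H$, $[N]\mapsto[H\times_KN]$; 3. $c_g$ corresponds to $SK^H\to SK^{gHg^{-1}}$, sending $[N]$ to the class of $N$ on which $y\in gHg^{-1}$ acts as $g^{-1}yg\in H$. -/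

import Mathlib

open scoped Manifold ContDiff
open Set
universe u
noncomputable section
namespace EquivariantSK

section Transfer

variable {E H : Type*} [NormedAddCommGroup E] [NormedSpace ℝ E] [TopologicalSpace H]
  {I : ModelWithCorners ℝ E H} {M : Type*} [TopologicalSpace M] [ChartedSpace H M]
  {P : Type*} [TopologicalSpace P]

/-- The charted space structure on `P` obtained from local identifications `σ p` (one around every
point `p`) of `P` with open pieces of a manifold `M`. -/
@[reducible] def chartedSpaceOfLocal (σ : P → OpenPartialHomeomorph P M)
    (hσ : ∀ p, p ∈ (σ p).source) : ChartedSpace H P where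
  atlas := {e | ∃ p, e = (σ p).trans (chartAt H (σ p p))}
  chartAt p := (σ p).trans (chartAt H (σ p p))
  mem_chart_source p := by simp [hσ p]
  chart_mem_atlas p := ⟨p, rfl⟩

variable [IsManifold I ∞ M] {σ : P → OpenPartialHomeomorph P M} {hσ : ∀ p, p ∈ (σ p).source}

theorem isManifold_of_local (hc : ∀ p q, ContMDiffOn I I ∞ ((σ p).symm.trans (σ q))
      ((σ p).symm.trans (σ q)).source) :
    @IsManifold ℝ _ E _ _ H _ I ∞ P _ (chartedSpaceOfLocal σ hσ) := by
  let _ := chartedSpaceOfLocal (H := H) σ hσ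
  apply isManifold_of_contDiffOn
  rintro _ _ ⟨p, rfl⟩ ⟨q, rfl⟩
  rw [← contMDiffOn_iff_contDiffOn]
  apply I.contMDiff.comp_contMDiffOn
  have h1 := contMDiffOn_of_mem_maximalAtlas (I := I) (n := ∞)
    (IsManifold.chart_mem_maximalAtlas (I := I) (n := ∞) (σ q q))
  have h2 := contMDiffOn_symm_of_mem_maximalAtlas (I := I) (n := ∞)
    (IsManifold.chart_mem_maximalAtlas (I := I) (n := ∞) (σ p p))
  have h3 : ContMDiffOn 𝓘(ℝ, E) I ∞ ((chartAt H (σ p p)).symm ∘ I.symm)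
      (I.symm ⁻¹' (((σ p).trans (chartAt H (σ p p))).symm.trans
        ((σ q).trans (chartAt H (σ q q)))).source ∩ range I) := by
    refine h2.comp (I.contMDiffOn_symm.mono inter_subset_right) ?_
    rintro x ⟨hx, -⟩
    simp only [mfld_simps] at hx ⊢
    exact hx.1.1
  have h4 := (hc p q).comp h3 (by
    rintro x ⟨hx, -⟩
    simp only [mfld_simps] at hx ⊢
    exact ⟨hx.1.2, hx.2.1⟩)
  refine (h1.comp h4 ?_).congr ?_
  · rintro x ⟨hx, -⟩
    simp only [mfld_simps] at hx ⊢
    exact hx.2.2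
  · intro x hx
    simp

theorem contMDiffOn_of_local (hc : ∀ p q, ContMDiffOn I I ∞ ((σ p).symm.trans (σ q))
      ((σ p).symm.trans (σ q)).source) (p : P) :
    letI := chartedSpaceOfLocal (H := H) σ hσ
    ContMDiffOn I I ∞ (σ p) (σ p).source ∧ ContMDiffOn I I ∞ (σ p).symm (σ p).target := by
  let _ := chartedSpaceOfLocal (H := H) σ hσ
  have : IsManifold I ∞ P := isManifold_of_local hc
  have key : ∀ q : P, ContMDiffOn I I ∞ (((σ q).trans (chartAt H (σ q q))))
      ((σ q).trans (chartAt H (σ q q))).source ∧ ContMDiffOn I I ∞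
      (((σ q).trans (chartAt H (σ q q)))).symm ((σ q).trans (chartAt H (σ q q))).target :=
    fun q => ⟨contMDiffOn_of_mem_maximalAtlas (I := I) (n := ∞)
      (IsManifold.subset_maximalAtlas ⟨q, rfl⟩),
      contMDiffOn_symm_of_mem_maximalAtlas (I := I) (n := ∞)
      (IsManifold.subset_maximalAtlas ⟨q, rfl⟩)⟩
  have chart := fun m : M => contMDiffOn_of_mem_maximalAtlas (I := I) (n := ∞)
    (IsManifold.chart_mem_maximalAtlas (I := I) (n := ∞) m)
  have chart' := fun m : M => contMDiffOn_symm_of_mem_maximalAtlas (I := I) (n := ∞)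
    (IsManifold.chart_mem_maximalAtlas (I := I) (n := ∞) m)
  constructor
  · intro q hq
    set e := (σ q).trans (chartAt H (σ q q)) with he
    have hqe : q ∈ e.source := by simp [e, hσ q]
    have a := ((chart' (σ q q)).comp (key q).1 (fun x hx => e.mapsTo hx |>.1))
    have b := (hc q p).comp (a.mono (s := e.source)  inter_subset_left (t := e.source ∩ (σ p).source)) (by
      rintro x ⟨hx, hx'⟩
      have hx2 := hx
      simp only [e, mfld_simps] at hx2
      simp [hx2, hx'])
    refine ((b.congr (f₁ := σ p) ?_) q ⟨hqe, hq⟩).mono_of_mem_nhdsWithin ?_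
    · rintro x ⟨hx, hx'⟩
      simp only [e, mfld_simps] at hx
      simp [hx]
    · exact mem_nhdsWithin_of_mem_nhds
        ((e.open_source.inter (σ p).open_source).mem_nhds ⟨hqe, hq⟩)
  · intro m hm
    set q := (σ p).symm m with hq
    have hqp : q ∈ (σ p).source := (σ p).map_target hm
    set e := (σ q).trans (chartAt H (σ q q)) with he
    have hqe : q ∈ e.source := by simp [e, hσ q]
    set s := (σ p).target ∩ (σ p).symm ⁻¹' e.source
    have hs : IsOpen s := (σ p).isOpen_inter_preimage_symm e.open_source
    have hsub : s ⊆ ((σ p).symm.trans (σ q)).source := by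
      rintro x ⟨hx, hx'⟩
      simp only [e, mfld_simps] at hx' ⊢
      exact ⟨hx, hx'.1⟩
    have a := (chart (σ q q)).comp ((hc p q).mono hsub) (by
      rintro x ⟨hx, hx'⟩
      simp only [e, mfld_simps] at hx' ⊢
      exact hx'.2)
    have b := (key q).2.comp a (by
      rintro x ⟨hx, hx'⟩
      exact e.map_source hx')
    refine ((b.congr (f₁ := (σ p).symm) ?_) m ⟨hm, hqe⟩).mono_of_mem_nhdsWithin ?_
    · rintro x ⟨hx, hx'⟩
      exact (e.left_inv hx').symm
    · exact mem_nhdsWithin_of_mem_nhds (hs.mem_nhds ⟨hm, hqe⟩)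

theorem contMDiff_of_local (hc : ∀ p q, ContMDiffOn I I ∞ ((σ p).symm.trans (σ q))
      ((σ p).symm.trans (σ q)).source) {F : P → P} (hF : Continuous F)
    (h : ∀ p, ContMDiffAt I I ∞ (σ (F p) ∘ F ∘ (σ p).symm) (σ p p)) :
    letI := chartedSpaceOfLocal (H := H) σ hσ
    ContMDiff I I ∞ F := by
  let _ := chartedSpaceOfLocal (H := H) σ hσ
  intro p
  have a := ((contMDiffOn_of_local (hσ := hσ) hc p).1).contMDiffAt
    ((σ p).open_source.mem_nhds (hσ p))
  have b := (h p).comp p a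
  have c : ContMDiffAt I I ∞ (σ (F p)).symm ((σ (F p) ∘ F ∘ (σ p).symm) (σ p p)) := by
    refine ((contMDiffOn_of_local (hσ := hσ) hc (F p)).2).contMDiffAt
      ((σ (F p)).open_target.mem_nhds ?_)
    simp [hσ]
  refine (c.comp p b).congr_of_eventuallyEq ?_
  filter_upwards [(σ p).open_source.mem_nhds (hσ p),
    ((σ (F p)).open_source.preimage hF).mem_nhds (hσ (F p))] with x hx hx'
  simp only [mem_preimage] at hx'
  simp [hx, hx']

end Transfer

/-! ### Compact smooth `G`-manifolds with boundary -/

/-- The local model of an `n`-manifold with boundary: the half-space `{x ∈ ℝⁿ | 0 ≤ x₀}` if `n > 0`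
and the point `ℝ⁰` if `n = 0`. -/
def HalfModel : ℕ → Type
  | 0 => EuclideanSpace ℝ (Fin 0)
  | n + 1 => EuclideanHalfSpace (n + 1)

instance instTopologicalSpaceHalfModel : (n : ℕ) → TopologicalSpace (HalfModel n)
  | 0 => inferInstanceAs (TopologicalSpace (EuclideanSpace ℝ (Fin 0)))
  | n + 1 => inferInstanceAs (TopologicalSpace (EuclideanHalfSpace (n + 1)))

/-- The model with corners of `n`-manifolds with boundary. -/
def halfI : (n : ℕ) → ModelWithCorners ℝ (EuclideanSpace ℝ (Fin n)) (HalfModel n)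
  | 0 => modelWithCornersSelf ℝ (EuclideanSpace ℝ (Fin 0))
  | n + 1 => modelWithCornersEuclideanHalfSpace (n + 1)

/-- A compact smooth `n`-dimensional manifold, possibly with boundary and possibly empty, with a
smooth action of the (finite, discrete) group `G`. -/
structure GManifold (G : Type u) [Group G] (n : ℕ) where
  /-- the underlying set -/
  carrier : Type u
  [top : TopologicalSpace carrier]
  [charted : ChartedSpace (HalfModel n) carrier]
  [isManifold : IsManifold (halfI n) ∞ carrier]
  [compact : CompactSpace carrier]
  [t2 : T2Space carrier]
  [act : MulAction G carrier]
  contMDiff_smul : ∀ g : G, ContMDiff (halfI n) (halfI n) ∞ fun x : carrier => g • x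

instance {G : Type u} [Group G] {n : ℕ} : CoeSort (GManifold G n) (Type u) := ⟨GManifold.carrier⟩

attribute [instance] GManifold.top GManifold.charted GManifold.isManifold GManifold.compact
  GManifold.t2 GManifold.act

/-- A compact `n`-dimensional `G`-manifold `M` with a continuous `G`-map `M → X`. -/
structure SingularGManifold (G : Type u) [Group G] (n : ℕ) (X : Type u) [TopologicalSpace X]
    [MulAction G X] extends GManifold G n where
  /-- the reference map -/
  ref : carrier → X
  continuous_ref : Continuous ref
  ref_smul : ∀ (g : G) (x : carrier), ref (g • x) = g • ref x

section Basic

variable {G : Type u} [Group G] {n : ℕ} {X : Type u} [TopologicalSpace X] [MulAction G X]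

instance : CoeSort (SingularGManifold G n X) (Type u) := ⟨fun M => M.carrier⟩

/-- `G`-diffeomorphism over `X`. -/
def IsoOver (M M' : SingularGManifold G n X) : Prop :=
  ∃ φ : Diffeomorph (halfI n) (halfI n) M M' ∞,
    (∀ (g : G) (x : M), φ (g • x) = g • φ x) ∧ ∀ x : M, M'.ref (φ x) = M.ref x

instance singularSetoid (G : Type u) [Group G] (n : ℕ) (X : Type u) [TopologicalSpace X]
    [MulAction G X] : Setoid (SingularGManifold G n X) where
  r := IsoOver
  iseqv :=
    { refl := fun M => ⟨Diffeomorph.refl _ _ _, fun _ _ => rfl, fun _ => rfl⟩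
      symm := by
        rintro M M' ⟨φ, h1, h2⟩
        refine ⟨φ.symm, fun g x => ?_, fun x => ?_⟩
        · apply φ.injective
          have := h1 g (φ.symm x)
          simp only [Diffeomorph.apply_symm_apply] at this ⊢
          exact (φ.apply_symm_apply (g • x)).trans this.symm
        · rw [← h2]
          simp
      trans := by
        rintro M M' M'' ⟨φ, h1, h2⟩ ⟨ψ, h3, h4⟩
        refine ⟨φ.trans ψ, fun g x => ?_, fun x => ?_⟩
        · simp [h1, h3]
        · simp [h2, h4] }

namespace SingularGManifold

/-- The empty singular manifold. -/
def empty (G : Type u) [Group G] (n : ℕ) (X : Type u) [TopologicalSpace X] [MulAction G X] :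
    SingularGManifold G n X :=
  letI : ChartedSpace (HalfModel n) PEmpty.{u + 1} := ChartedSpace.empty _ _
  { carrier := PEmpty.{u + 1}
    act :=
      { smul := fun _ x => x
        one_smul := fun x => x.elim
        mul_smul := fun _ _ x => x.elim }
    isManifold := { compatible := fun {e} _ he => absurd he (Set.notMem_empty e) }
    contMDiff_smul := fun _ x => x.elim
    ref := fun x => x.elim
    continuous_ref := continuous_of_discreteTopology
    ref_smul := fun _ x => x.elim }

/-- The disjoint union of two singular manifolds. -/
def sum (M M' : SingularGManifold G n X) : SingularGManifold G n X where
  carrier := M ⊕ M'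
  contMDiff_smul g := (M.contMDiff_smul g).sumMap (M'.contMDiff_smul g)
  ref := Sum.elim M.ref M'.ref
  continuous_ref := M.continuous_ref.sumElim M'.continuous_ref
  ref_smul := by
    rintro g (x | x)
    · exact M.ref_smul g x
    · exact M'.ref_smul g x

end SingularGManifold

/-- The set `ℳ^G(X)` of `G`-diffeomorphism classes over `X` of singular `n`-manifolds in `X`. -/
def SingularClass (G : Type u) [Group G] (n : ℕ) (X : Type u) [TopologicalSpace X]
    [MulAction G X] : Type (u + 1) :=
  Quotient (singularSetoid G n X)

/-- The class of a singular manifold in `ℳ^G(X)`. -/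
def SingularClass.mk (M : SingularGManifold G n X) : SingularClass G n X :=
  Quotient.mk _ M

instance : Zero (SingularClass G n X) := ⟨SingularClass.mk (SingularGManifold.empty G n X)⟩

/-- Addition is disjoint union. -/
instance : Add (SingularClass G n X) where
  add := Quotient.map₂ SingularGManifold.sum (by
    rintro A A' ⟨φ, h1, h2⟩ B B' ⟨ψ, h3, h4⟩
    refine ⟨φ.sumCongr ψ, ?_, ?_⟩
    · rintro g (x | x)
      · exact congrArg Sum.inl (h1 g x)
      · exact congrArg Sum.inr (h3 g x)
    · rintro (x | x)
      · exact h2 x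
      · exact h4 x)

/-- `ℳ^G(X)` is a commutative monoid under disjoint union. -/
instance : AddCommMonoid (SingularClass G n X) where
  nsmul := nsmulRec
  add_assoc := by
    rintro ⟨A⟩ ⟨B⟩ ⟨C⟩
    refine Quotient.sound ⟨Diffeomorph.sumAssoc _ _ _ _ _, ?_, ?_⟩
    · rintro g ((x | x) | x) <;> rfl
    · rintro ((x | x) | x) <;> rfl
  zero_add := by
    rintro ⟨A⟩
    have : IsEmpty (SingularGManifold.empty G n X) := inferInstanceAs (IsEmpty PEmpty)
    refine Quotient.sound ⟨(Diffeomorph.sumComm _ _ _ _).trans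
      (Diffeomorph.sumEmpty _ _ _), ?_, ?_⟩
    · rintro g (x | x)
      · exact x.elim
      · rfl
    · rintro (x | x)
      · exact x.elim
      · rfl
  add_zero := by
    rintro ⟨A⟩
    have : IsEmpty (SingularGManifold.empty G n X) := inferInstanceAs (IsEmpty PEmpty)
    refine Quotient.sound ⟨Diffeomorph.sumEmpty _ _ _, ?_, ?_⟩
    · rintro g (x | x)
      · rfl
      · exact x.elim
    · rintro (x | x)
      · rfl
      · exact x.elim
  add_comm := by
    rintro ⟨A⟩ ⟨B⟩
    refine Quotient.sound ⟨Diffeomorph.sumComm _ _ _ _, ?_, ?_⟩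
    · rintro g (x | x) <;> rfl
    · rintro (x | x) <;> rfl

/-! ### Cutting and pasting -/

/-- Equivariant smooth embeddings: injective immersions that are topological embeddings. (The
normal form of `Manifold.IsImmersion` is not usable here: it does not allow a boundary point of a
1-manifold to be sent to an interior point.) -/
structure IsGEmbedding {N M : GManifold G n} (j : N → M) : Prop where
  contMDiff : ContMDiff (halfI n) (halfI n) ∞ j
  injective_mfderiv : ∀ x, Function.Injective (mfderiv (halfI n) (halfI n) j x)
  isEmbedding : Topology.IsEmbedding j
  map_smul : ∀ (g : G) (x : N), j (g • x) = g • j x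

/-- `M` is obtained by pasting the `n`-dimensional `G`-manifolds `M₁` and `M₂` along the parts `S₁`
and `S₂` of their boundaries: `M₁` and `M₂` are smoothly and equivariantly embedded by `j₁` and `j₂`
in `M`, which they cover, and they meet exactly in `Σ = j₁(S₁) = j₂(S₂)`, which is disjoint from
`∂M`. The pasting diffeomorphism is `j₂⁻¹ ∘ j₁ : S₁ → S₂`. Conversely, `M₁` and `M₂` are the
results of cutting `M` along the separating invariant hypersurface `Σ`; as `M₁` and `M₂` lie on
the two sides of `Σ` and are invariant, the normal bundle of `Σ` is trivial, with trivial action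
of `G` on the normal direction. -/
structure IsPasting (M₁ M₂ : GManifold G n) (S₁ : Set M₁) (S₂ : Set M₂) (M : GManifold G n)
    (j₁ : M₁ → M) (j₂ : M₂ → M) : Prop where
  embedding₁ : IsGEmbedding j₁
  embedding₂ : IsGEmbedding j₂
  subset_boundary₁ : S₁ ⊆ (halfI n).boundary M₁
  subset_boundary₂ : S₂ ⊆ (halfI n).boundary M₂
  range_union : range j₁ ∪ range j₂ = univ
  range_inter₁ : range j₁ ∩ range j₂ = j₁ '' S₁
  range_inter₂ : range j₁ ∩ range j₂ = j₂ '' S₂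
  disjoint_boundary : Disjoint (range j₁ ∩ range j₂) ((halfI n).boundary M)

/-- `G`-homotopy of maps from a `G`-space `A` to the `G`-space `X`. -/
def GHomotopic (G : Type u) [Group G] {A X : Type u} [TopologicalSpace A] [MulAction G A]
    [TopologicalSpace X] [MulAction G X] (f f' : A → X) : Prop :=
  ∃ F : unitInterval × A → X, Continuous F ∧ (∀ a, F (0, a) = f a) ∧ (∀ a, F (1, a) = f' a) ∧
    ∀ (g : G) (t : unitInterval) (a : A), F (t, g • a) = g • F (t, a)

/-- `M` and `M'` are obtained from each other by an `SK`-operation in `X`: they are pasted from the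
same two pieces along the same parts of the boundaries, with possibly different pasting
diffeomorphisms, and their reference maps are `G`-homotopic on each of the two pieces. -/
def SKOperation (M M' : SingularGManifold G n X) : Prop :=
  ∃ (M₁ M₂ : GManifold G n) (S₁ : Set M₁) (S₂ : Set M₂) (j₁ : M₁ → M) (j₂ : M₂ → M)
    (j₁' : M₁ → M') (j₂' : M₂ → M'),
    IsPasting M₁ M₂ S₁ S₂ M.toGManifold j₁ j₂ ∧ IsPasting M₁ M₂ S₁ S₂ M'.toGManifold j₁' j₂' ∧
    GHomotopic G (M.ref ∘ j₁) (M'.ref ∘ j₁') ∧ GHomotopic G (M.ref ∘ j₂) (M'.ref ∘ j₂')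

/-- The subgroup of the group completion of `ℳ^G(X)` spanned by the differences of singular
manifolds that are related by an `SK`-operation in `X`. -/
def skRelations (G : Type u) [Group G] (n : ℕ) (X : Type u) [TopologicalSpace X]
    [MulAction G X] : AddSubgroup (Algebra.GrothendieckAddGroup (SingularClass G n X)) :=
  AddSubgroup.closure {d | ∃ M M' : SingularGManifold G n X, SKOperation M M' ∧
    d = Algebra.GrothendieckAddGroup.of (SingularClass.mk M) -
      Algebra.GrothendieckAddGroup.of (SingularClass.mk M')}

/-- The group `SK^G(X)` in dimension `n`. -/
abbrev SK (G : Type u) [Group G] (n : ℕ) (X : Type u) [TopologicalSpace X] [MulAction G X] :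
    Type (u + 1) :=
  Algebra.GrothendieckAddGroup (SingularClass G n X) ⧸ skRelations G n X

/-- The class `[M → X]` in `SK^G(X)`. -/
def SingularGManifold.cls (M : SingularGManifold G n X) : SK G n X :=
  QuotientAddGroup.mk
    (Algebra.GrothendieckAddGroup.of (SingularClass.mk M))

/-- The group `SK^G`: the case where `X` is a point. -/
abbrev SKPoint (G : Type u) [Group G] (n : ℕ) : Type (u + 1) := SK G n PUnit.{u + 1}

/-- A `G`-manifold, as a singular manifold in the point. -/
def GManifold.toPoint (N : GManifold G n) : SingularGManifold G n PUnit.{u + 1} where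
  toGManifold := N
  ref _ := PUnit.unit
  continuous_ref := continuous_const
  ref_smul _ _ := rfl

/-- The class `[N]` in `SK^G`. -/
def GManifold.cls (N : GManifold G n) : SKPoint G n := N.toPoint.cls

end Basic

/-! ### Restriction, conjugation and fibres -/

/-- The pullback of a group action along a homomorphism `φ : K → H`: an `H`-manifold `N` becomes a
`K`-manifold with `k` acting as `φ k`. -/
def GManifold.restrict {H K : Type u} [Group H] [Group K] {n : ℕ} (φ : K →* H)
    (N : GManifold H n) : GManifold K n where
  carrier := N
  act := MulAction.compHom N φ
  contMDiff_smul k := N.contMDiff_smul (φ k)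

section Cosets

variable {G : Type u} [Group G]

/-- The projection `G/K → G/H`, `xK ↦ xH`, for `K ≤ H`. -/
def cosetProj {K H : Subgroup G} (h : K ≤ H) : (G ⧸ K) →[G] (G ⧸ H) where
  toFun := Subgroup.quotientMapOfLE h
  map_smul' := by
    rintro g ⟨x⟩
    rfl

/-- The conjugate subgroup `gHg⁻¹`. -/
abbrev conjSubgroup (g : G) (H : Subgroup G) : Subgroup G :=
  H.map (MulAut.conj g).toMonoidHom

/-- The isomorphism `gHg⁻¹ → H`, `y ↦ g⁻¹yg`. -/
def conjHom (g : G) (H : Subgroup G) : conjSubgroup g H →* H where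
  toFun y := ⟨g⁻¹ * y * g, by
    obtain ⟨_, h, hh, rfl⟩ := y
    simpa [mul_assoc] using hh⟩
  map_one' := by simp
  map_mul' x y := by
    ext
    simp [mul_assoc]

/-- The isomorphism of `G`-sets `G/H → G/gHg⁻¹`, `xH ↦ xg⁻¹(gHg⁻¹)`. -/
def cosetConj (g : G) (H : Subgroup G) : (G ⧸ H) →[G] (G ⧸ conjSubgroup g H) where
  toFun := Quotient.map' (fun x => x * g⁻¹) (by
    intro a b hab
    rw [QuotientGroup.leftRel_apply] at hab ⊢
    exact ⟨_, hab, by simp [mul_assoc]⟩)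
  map_smul' := by
    rintro y ⟨x⟩
    exact congrArg QuotientGroup.mk (mul_assoc y x g⁻¹)

variable [TopologicalSpace G] [DiscreteTopology G] {n : ℕ}

instance instDiscreteCosets (H : Subgroup G) : DiscreteTopology (G ⧸ H) :=
  QuotientGroup.discreteTopology (isOpen_discrete _)

/-- The `H`-manifold `f⁻¹(eH)` for a singular manifold `f : M → G/H`, an open (and closed) subset of
`M`. -/
def SingularGManifold.fibre {H : Subgroup G} (M : SingularGManifold G n (G ⧸ H)) :
    GManifold H n :=
  let U : TopologicalSpace.Opens M :=
    ⟨M.ref ⁻¹' {((1 : G) : G ⧸ H)}, (isOpen_discrete _).preimage M.continuous_ref⟩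
  { carrier := U
    compact := by
      have h : IsCompact (U : Set M) :=
        ((isClosed_discrete {((1 : G) : G ⧸ H)}).preimage M.continuous_ref).isCompact
      exact isCompact_iff_compactSpace.mp h
    act :=
      { smul := fun h x => ⟨(h : G) • (x : M), by
          have hx : M.ref x = ((1 : G) : G ⧸ H) := x.2
          change M.ref ((h : G) • (x : M)) = ((1 : G) : G ⧸ H)
          rw [M.ref_smul, hx, MulAction.Quotient.smul_coe, smul_eq_mul, mul_one]
          exact QuotientGroup.eq.mpr (by simp)⟩
        one_smul := fun x => Subtype.ext (one_smul G (x : M))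
        mul_smul := fun h k x => Subtype.ext (mul_smul (h : G) (k : G) (x : M)) }
    contMDiff_smul := fun h => by
      refine (ContMDiff.iff_comp_isImmersion
        (Manifold.IsImmersion.of_opens (I := halfI n) (n := ∞) U)).mpr ⟨?_, ?_⟩
      · exact (((M.contMDiff_smul (h : G)).continuous).comp continuous_subtype_val).subtype_mk _
      · exact (M.contMDiff_smul (h : G)).comp contMDiff_subtype_val }

end Cosets

/-! ### The maps induced by spans of finite `G`-sets -/

section Span

variable {G : Type u} [Group G] {n : ℕ}
  {X : Type u} [TopologicalSpace X] [DiscreteTopology X] [MulAction G X]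
  {U : Type u} [TopologicalSpace U] [DiscreteTopology U] [MulAction G U]
  {Y : Type u} [TopologicalSpace Y] [MulAction G Y]

/-- The projection of `M ×_X U` to `M`, restricted to the points with the same second coordinate as
`p`, is an open embedding. -/
def pullbackChart (M : SingularGManifold G n X) (α : U →[G] X) (p : M.ref.Pullback α) :
    OpenPartialHomeomorph (M.ref.Pullback α) M where
  toFun q := q.1.1
  invFun m := open Classical in if h : M.ref m = α p.1.2 then ⟨(m, p.1.2), h⟩ else p
  source := {q | q.1.2 = p.1.2}
  target := {m | M.ref m = α p.1.2}
  map_source' := by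
    rintro ⟨⟨m, u⟩, h⟩ rfl
    exact h
  map_target' := by
    intro m (h : M.ref m = α p.1.2)
    simp [h]
  left_inv' := by
    rintro ⟨⟨m, u⟩, h⟩ hq
    have hu : u = p.1.2 := hq
    subst hu
    exact dif_pos h
  right_inv' := by
    intro m (h : M.ref m = α p.1.2)
    simp [h]
  open_source := (isOpen_discrete {p.1.2}).preimage (continuous_snd.comp continuous_subtype_val)
  open_target := (isOpen_discrete {α p.1.2}).preimage M.continuous_ref
  continuousOn_toFun := (continuous_fst.comp continuous_subtype_val).continuousOn
  continuousOn_invFun := by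
    refine (Topology.IsInducing.subtypeVal (t := {q : M × U | M.ref q.1 = α q.2})).continuousOn_iff.mpr ?_
    refine ((continuous_id.prodMk continuous_const).continuousOn
      (f := fun m : M => (m, p.1.2))).congr ?_
    intro m (h : M.ref m = α p.1.2)
    simp [h]

theorem pullbackChart_compat (M : SingularGManifold G n X) (α : U →[G] X)
    (p q : M.ref.Pullback α) :
    ContMDiffOn (halfI n) (halfI n) ∞ ((pullbackChart M α p).symm.trans (pullbackChart M α q))
      ((pullbackChart M α p).symm.trans (pullbackChart M α q)).source := by
  refine contMDiffOn_id.congr ?_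
  rintro m ⟨hm, -⟩
  exact (pullbackChart M α p).right_inv hm

/-- The value on the singular manifold `f : M → X` of the operation associated with the span
`X ←α- U -β→ Y` of finite `G`-sets: the pullback `M ×_X U` of `f` along `α`, with the smooth
structure for which the projection to `M` is a local diffeomorphism and with the diagonal action,
mapped to `Y` by `β` after the projection to `U`. -/
def SingularGManifold.span [Finite U] (α : U →[G] X) (β : U →[G] Y)
    (M : SingularGManifold G n X) : SingularGManifold G n Y :=
  letI : ChartedSpace (HalfModel n) (M.ref.Pullback α) :=
    chartedSpaceOfLocal (pullbackChart M α) (fun _ => rfl)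
  letI : MulAction G (M.ref.Pullback α) :=
    { smul := fun g p => ⟨(g • p.1.1, g • p.1.2), by
        rw [M.ref_smul, map_smul, p.2]⟩
      one_smul := fun p => Subtype.ext (Prod.ext (one_smul G p.1.1) (one_smul G p.1.2))
      mul_smul := fun g h p => Subtype.ext
        (Prod.ext (mul_smul g h p.1.1) (mul_smul g h p.1.2)) }
  { carrier := M.ref.Pullback α
    isManifold := isManifold_of_local (pullbackChart_compat M α)
    compact := by
      have h : IsCompact {p : M × U | M.ref p.1 = α p.2} := by
        refine IsClosed.isCompact ?_
        have hc : Continuous fun p : M × U => (M.ref p.1, α p.2) :=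
          (M.continuous_ref.comp continuous_fst).prodMk
            ((continuous_of_discreteTopology (f := α)).comp continuous_snd)
        exact (isClosed_discrete {x : X × X | x.1 = x.2}).preimage hc
      exact isCompact_iff_compactSpace.mp h
    contMDiff_smul := fun g => by
      refine contMDiff_of_local (pullbackChart_compat M α) ?_ ?_
      · exact (((M.contMDiff_smul g).continuous.comp
          (continuous_fst.comp continuous_subtype_val)).prodMk
          ((continuous_of_discreteTopology (f := fun u : U => g • u)).comp
          (continuous_snd.comp continuous_subtype_val))).subtype_mk _
      · intro p
        refine ((M.contMDiff_smul g) _).congr_of_eventuallyEq ?_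
        filter_upwards [(pullbackChart M α p).open_target.mem_nhds
          ((pullbackChart M α p).map_source rfl)] with m hm
        exact congrArg (fun x : M => g • x) ((pullbackChart M α p).right_inv hm)
    ref := fun p => β p.1.2
    continuous_ref := (continuous_of_discreteTopology (f := β)).comp
      (continuous_snd.comp continuous_subtype_val)
    ref_smul := fun g p => map_smul β g p.1.2 }

end Span

/-! ### Induction -/

section Induction

variable {H K : Type u} [Group H] [Group K] {n : ℕ}

/-- The product `H × N` for a homomorphism `φ : K → H` and a `K`-manifold `N`. -/
def BalancedPre (_φ : K →* H) (N : GManifold K n) : Type u := H × N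

instance [TopologicalSpace H] (φ : K →* H) (N : GManifold K n) :
    TopologicalSpace (BalancedPre φ N) :=
  inferInstanceAs (TopologicalSpace (H × N))

/-- `K` acts on `H × N` by `k • (h, x) = (hφ(k)⁻¹, kx)`. -/
instance (φ : K →* H) (N : GManifold K n) : MulAction K (BalancedPre φ N) where
  smul k p := (p.1 * (φ k)⁻¹, k • p.2)
  one_smul p := Prod.ext (by change p.1 * (φ 1)⁻¹ = p.1; simp) (one_smul K p.2)
  mul_smul k l p := Prod.ext
    (by change p.1 * (φ (k * l))⁻¹ = p.1 * (φ l)⁻¹ * (φ k)⁻¹; simp [mul_assoc])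
    (mul_smul k l p.2)

/-- The balanced product `H ×_K N = (H × N)/K`, in which `(hφ(k), x) ~ (h, kx)`. -/
abbrev BalancedProduct (φ : K →* H) (N : GManifold K n) : Type u :=
  MulAction.orbitRel.Quotient K (BalancedPre φ N)

namespace BalancedProduct

variable {φ : K →* H} {N : GManifold K n}

/-- The class of `(h, x)` in `H ×_K N`. -/
def mk (φ : K →* H) (N : GManifold K n) (h : H) (x : N) : BalancedProduct φ N :=
  Quotient.mk _ ((h, x) : H × N)

theorem mk_eq_iff {h h' : H} {x x' : N} :
    mk φ N h x = mk φ N h' x' ↔ ∃ k : K, h' * (φ k)⁻¹ = h ∧ k • x' = x := by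
  refine Quotient.eq.trans ⟨?_, ?_⟩
  · rintro ⟨k, hk⟩
    exact ⟨k, congrArg Prod.fst hk, congrArg Prod.snd hk⟩
  · rintro ⟨k, hk, hk'⟩
    exact ⟨k, Prod.ext hk hk'⟩

theorem exists_mk (q : BalancedProduct φ N) : ∃ p : H × N, mk φ N p.1 p.2 = q :=
  Quotient.exists_rep q

/-- The action `g • [h, x] = [gh, x]` of `H` on `H ×_K N`. -/
instance : MulAction H (BalancedProduct φ N) where
  smul g := Quotient.map' (fun p : BalancedPre φ N => ((g * p.1, p.2) : H × N)) (by
    rintro _ p ⟨k, rfl⟩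
    exact ⟨k, Prod.ext (mul_assoc g p.1 (φ k)⁻¹) rfl⟩)
  one_smul := by
    rintro ⟨p⟩
    exact congrArg (Quotient.mk _) (Prod.ext (one_mul p.1) rfl : ((1 * p.1, p.2) : H × N) = p)
  mul_smul := by
    rintro g h ⟨p⟩
    exact congrArg (Quotient.mk _)
      (Prod.ext (mul_assoc g h p.1) rfl : ((g * h * p.1, p.2) : H × N) = (g * (h * p.1), p.2))

theorem smul_mk (g h : H) (x : N) : g • mk φ N h x = mk φ N (g * h) x := rfl

variable [TopologicalSpace H] [DiscreteTopology H]

instance : ContinuousConstSMul K (BalancedPre φ N) where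
  continuous_const_smul k :=
    ((continuous_of_discreteTopology (f := fun h : H => h * (φ k)⁻¹)).comp continuous_fst).prodMk
      ((N.contMDiff_smul k).continuous.comp continuous_snd)

instance : T2Space (BalancedPre φ N) := inferInstanceAs (T2Space (H × N))

instance [Finite H] : CompactSpace (BalancedPre φ N) := inferInstanceAs (CompactSpace (H × N))

theorem continuous_mk (h : H) : Continuous (mk φ N h) :=
  continuous_quotient_mk'.comp (continuous_const.prodMk continuous_id)

theorem isOpenEmbedding_mk (hφ : Function.Injective φ) (h : H) :
    Topology.IsOpenEmbedding (mk φ N h) := by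
  refine .of_continuous_injective_isOpenMap (continuous_mk h) ?_ ?_
  · intro x y hxy
    obtain ⟨k, hk, hk'⟩ := mk_eq_iff.mp hxy
    have : k = 1 := hφ (by simpa using hk)
    simpa [this] using hk'.symm
  · have h1 : IsOpenMap (fun x : N => ((h, x) : H × N)) := by
      intro s hs
      have : (fun x : N => ((h, x) : H × N)) '' s = {h} ×ˢ s := by
        ext ⟨a, b⟩
        simp [eq_comm, and_comm]
      rw [this]
      exact (isOpen_discrete _).prod hs
    exact (isOpenMap_quotient_mk'_mul (Γ := K) (T := BalancedPre φ N)).comp h1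

/-- The partial inverse of the open embedding `N → H ×_K N`, `x ↦ [h, x]`. -/
def chart (hφ : Function.Injective φ) (h : H) (x₀ : N) :
    OpenPartialHomeomorph (BalancedProduct φ N) N :=
  haveI : Nonempty N := ⟨x₀⟩
  ((isOpenEmbedding_mk (N := N) hφ h).toOpenPartialHomeomorph _).symm

/-- The inverse of `x ↦ [h, x]`, where `h` is the first coordinate of a representative of `q`. -/
def chartAt' (hφ : Function.Injective φ) (q : BalancedProduct φ N) :
    OpenPartialHomeomorph (BalancedProduct φ N) N :=
  chart hφ (exists_mk q).choose.1 (exists_mk q).choose.2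

theorem chart_symm_apply (hφ : Function.Injective φ) (h : H) (x₀ x : N) :
    (chart hφ h x₀).symm x = mk φ N h x := rfl

theorem chart_source (hφ : Function.Injective φ) (h : H) (x₀ : N) :
    (chart hφ h x₀).source = range (mk φ N h) := by
  simp [chart]

theorem chart_mk (hφ : Function.Injective φ) (h : H) (x₀ x : N) :
    chart hφ h x₀ (mk φ N h x) = x := by
  have : Nonempty N := ⟨x₀⟩
  exact (isOpenEmbedding_mk (N := N) hφ h).toOpenPartialHomeomorph_left_inv

theorem mem_chartAt'_source (hφ : Function.Injective φ) (q : BalancedProduct φ N) :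
    q ∈ (chartAt' hφ q).source := by
  rw [chartAt', chart_source]
  exact ⟨_, (exists_mk q).choose_spec⟩

theorem contMDiffOn_chart (hφ : Function.Injective φ) (h h' : H) (x₀ : N) :
    ContMDiffOn (halfI n) (halfI n) ∞ (chart hφ h' x₀ ∘ mk φ N h)
      (mk φ N h ⁻¹' range (mk φ N h')) := by
  by_cases hk : ∃ k : K, h * (φ k)⁻¹ = h'
  · obtain ⟨k, hk⟩ := hk
    refine (N.contMDiff_smul k).contMDiffOn.congr ?_
    intro x _
    have : mk φ N h x = mk φ N h' (k • x) := (mk_eq_iff.mpr ⟨k, hk, rfl⟩).symm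
    rw [Function.comp_apply, this, chart_mk]
  · intro x hx
    obtain ⟨y, hy⟩ := hx
    obtain ⟨k, hk', -⟩ := mk_eq_iff.mp hy
    exact absurd ⟨k, hk'⟩ hk

theorem compat (hφ : Function.Injective φ) (p q : BalancedProduct φ N) :
    ContMDiffOn (halfI n) (halfI n) ∞ ((chartAt' hφ p).symm.trans (chartAt' hφ q))
      ((chartAt' hφ p).symm.trans (chartAt' hφ q)).source := by
  refine (contMDiffOn_chart hφ _ _ (exists_mk q).choose.2).mono ?_
  rintro x ⟨-, hx⟩
  have hx' : (chartAt' hφ p).symm x ∈ (chartAt' hφ q).source := hx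
  rw [chartAt', chartAt', chart_source] at hx'
  exact hx'

end BalancedProduct

open BalancedProduct in
/-- The `H`-manifold `H ×_K N` induced from the `K`-manifold `N` along an injective homomorphism
`φ : K → H`, with the smooth structure for which all maps `N → H ×_K N`, `x ↦ [h, x]` are open
embeddings of smooth manifolds, and with the action `g • [h, x] = [gh, x]`. -/
def GManifold.induce [Finite H] [TopologicalSpace H] [DiscreteTopology H] (φ : K →* H)
    (hφ : Function.Injective φ) (N : GManifold K n) : GManifold H n :=
  letI : ChartedSpace (HalfModel n) (BalancedProduct φ N) :=
    chartedSpaceOfLocal (chartAt' hφ) (mem_chartAt'_source hφ)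
  { carrier := BalancedProduct φ N
    isManifold := isManifold_of_local (compat hφ)
    compact := Quotient.compactSpace
    t2 := by
      have : Finite K := Finite.of_injective φ hφ
      exact t2Space_of_properlyDiscontinuousSMul_of_t2Space
    contMDiff_smul := fun g => by
      refine contMDiff_of_local (compat hφ) ?_ ?_
      · refine continuous_quot_lift _ ?_
        exact continuous_quotient_mk'.comp
          (((continuous_of_discreteTopology (f := fun h : H => g * h)).comp continuous_fst).prodMk
            continuous_snd)
      · intro p
        set p₀ := (exists_mk p).choose
        have hp₀ : BalancedProduct.mk φ N p₀.1 p₀.2 = p := (exists_mk p).choose_spec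
        set q₀ := (exists_mk (g • p)).choose
        have hq₀ : BalancedProduct.mk φ N q₀.1 q₀.2 = g • p := (exists_mk (g • p)).choose_spec
        have hv : chartAt' hφ p p = p₀.2 := by
          conv_lhs => rw [← hp₀]
          rw [hp₀]
          change chart hφ p₀.1 p₀.2 p = p₀.2
          conv_lhs => rw [← hp₀]
          exact chart_mk hφ _ _ _
        rw [hv]
        refine (contMDiffOn_chart hφ (g * p₀.1) q₀.1 q₀.2).contMDiffAt
          (((isOpenEmbedding_mk hφ q₀.1).isOpen_range.preimage (continuous_mk _)).mem_nhds ?_)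
        refine ⟨q₀.2, ?_⟩
        rw [hq₀, ← hp₀, smul_mk] }

/-- The singular manifold `G ×_H N → G/H`, `[g, x] ↦ gH` of an `H`-manifold `N`. -/
def GManifold.induceOver {G : Type u} [Group G] [Finite G] [TopologicalSpace G]
    [DiscreteTopology G] (L : Subgroup G) (N : GManifold L n) : SingularGManifold G n (G ⧸ L) where
  toGManifold := N.induce L.subtype L.subtype_injective
  ref := Quotient.lift (fun p : BalancedPre L.subtype N => (p.1 : G ⧸ L)) (by
    rintro _ p ⟨k, rfl⟩
    refine QuotientGroup.eq.mpr ?_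
    change (p.1 * (k : G)⁻¹)⁻¹ * p.1 ∈ L
    simp)
  continuous_ref := continuous_quot_lift _
    ((continuous_of_discreteTopology (f := fun g : G => (g : G ⧸ L))).comp continuous_fst)
  ref_smul := by
    rintro g ⟨p⟩
    rfl

end Induction

/-! ### Homomorphisms of `SK`-groups induced by constructions on manifolds -/

section Maps

variable {G : Type u} [Group G] {n : ℕ}

/-- `T : SK^G(X) → SK^G(Y)` is the value of the Mackey functor `SK^G` on the span `X ←α- U -β→ Y` of
finite `G`-sets: it sends `[M, f]` to `[M ×_X U, β ∘ f~]`. -/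
def IsSpanMap {X U Y : Type u} [TopologicalSpace X] [DiscreteTopology X] [MulAction G X]
    [TopologicalSpace U] [DiscreteTopology U] [Finite U] [MulAction G U]
    [TopologicalSpace Y] [MulAction G Y] (α : U →[G] X) (β : U →[G] Y)
    (T : SK G n X →+ SK G n Y) : Prop :=
  ∀ M : SingularGManifold G n X, T M.cls = (M.span α β).cls

/-- `r : SK^H → SK^K` is given by restricting actions of `H` to `K ≤ H`. -/
def IsRestriction {K H : Subgroup G} (h : K ≤ H) (r : SKPoint H n →+ SKPoint K n) : Prop :=
  ∀ N : GManifold H n, r N.cls = (N.restrict (Subgroup.inclusion h)).cls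

/-- `t : SK^K → SK^H` is given by induction, `[N] ↦ [H ×_K N]`, for `K ≤ H`. -/
def IsInduction [Finite G] [TopologicalSpace G] [DiscreteTopology G] {K H : Subgroup G}
    (h : K ≤ H) (t : SKPoint K n →+ SKPoint H n) : Prop :=
  ∀ N : GManifold K n,
    t N.cls = (N.induce (Subgroup.inclusion h) (Subgroup.inclusion_injective h)).cls

/-- `c : SK^H → SK^{gHg⁻¹}` is given by transporting actions along `H ≅ gHg⁻¹`: the element `y` of
`gHg⁻¹` acts on `N` as `g⁻¹yg` does. -/
def IsConjugation (g : G) (H : Subgroup G)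
    (c : SKPoint H n →+ SKPoint (conjSubgroup g H) n) : Prop :=
  ∀ N : GManifold H n, c N.cls = (N.restrict (conjHom g H)).cls

end Maps

end EquivariantSK

end

/-!
All maps in the theorem come from constructions that turn a singular manifold `M` into another one,
`F M`, which locally looks like `M`: pullback along a span, restriction of the action, the fibre
over a coset, and induction. `LocalConstruction` isolates what they have in common. A continuous
equivariant map `j : M → M'` over `X` induces a map `F M → F M'`; every point of `F M` has an
underlying point of `M`; the image of `F M → F M'` consists of the points over `range j`; and
`F M → F M'` is injective, immersive or a local diffeomorphism whenever `j` is. Since bijective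
local diffeomorphisms are diffeomorphisms, such an `F` preserves isomorphism
(`LocalConstruction.isoOver`) and disjoint unions (`LocalConstruction.isoOver_sum`).

It also preserves `SK`-operations (`LocalConstruction.skOperation`). The point is that the reference
space `X` is discrete, so homotopic maps to `X` are equal: the two pieces of an operation carry well
defined maps to `X`, `F` applies to them, and the pasted pieces of `F M` are the images of `F M₁` and
`F M₂`. They meet exactly over the hypersurface along which `M₁` and `M₂` are pasted. So each
construction defines a unique homomorphism (`LocalConstruction.existsUnique_hom`).

The identities between these homomorphisms need to be checked on generators only, where they are
explicit diffeomorphisms: `x ↦ [1, x]` from `N` to the fibre of `G ×_H N`, `[g, x] ↦ gx` from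
`G ×_H f⁻¹(eH)` to `M`, and three similar ones for the fibres of the pullbacks along the spans of
restriction, transfer and conjugation. Each of them is bijective and is a local diffeomorphism
because it becomes one after composition with the local diffeomorphisms `f⁻¹(eH) → M`,
`M ×_X U → M` and `N → H ×_K N`, `x ↦ [h, x]`.
-/

namespace EquivariantSK

/-! ### Local diffeomorphisms and immersions -/

section LocalDiffeo

open Filter Topology

variable {E : Type*} [NormedAddCommGroup E] [NormedSpace ℝ E]
  {E' : Type*} [NormedAddCommGroup E'] [NormedSpace ℝ E']
  {E'' : Type*} [NormedAddCommGroup E''] [NormedSpace ℝ E'']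
  {A : Type*} [TopologicalSpace A] {A' : Type*} [TopologicalSpace A']
  {A'' : Type*} [TopologicalSpace A'']
  {I : ModelWithCorners ℝ E A} {I' : ModelWithCorners ℝ E' A'} {I'' : ModelWithCorners ℝ E'' A''}
  {P : Type*} [TopologicalSpace P] [ChartedSpace A P]
  {Q : Type*} [TopologicalSpace Q] [ChartedSpace A' Q]
  {R : Type*} [TopologicalSpace R] [ChartedSpace A'' R]

theorem isLocalDiffeomorphAt_congr {f g : P → Q} {x : P}
    (hf : IsLocalDiffeomorphAt I I' ∞ f x) (h : g =ᶠ[𝓝 x] f) :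
    IsLocalDiffeomorphAt I I' ∞ g x := by
  obtain ⟨Φ, hx, hΦ⟩ := hf
  obtain ⟨s, hs, hso, hxs⟩ := eventually_nhds_iff.mp h
  refine ⟨{ toPartialEquiv := (Φ.toOpenPartialHomeomorph.restrOpen s hso).toPartialEquiv
            open_source := (Φ.toOpenPartialHomeomorph.restrOpen s hso).open_source
            open_target := (Φ.toOpenPartialHomeomorph.restrOpen s hso).open_target
            contMDiffOn_toFun := Φ.contMDiffOn_toFun.mono inter_subset_left
            contMDiffOn_invFun := Φ.contMDiffOn_invFun.mono inter_subset_left },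
    ⟨hx, hxs⟩, ?_⟩
  rintro y ⟨hy, hys⟩
  exact (hs y hys).trans (hΦ hy)

theorem isLocalDiffeomorphAt_comp {f : P → Q} {g : Q → R} {x : P}
    (hg : IsLocalDiffeomorphAt I' I'' ∞ g (f x)) (hf : IsLocalDiffeomorphAt I I' ∞ f x) :
    IsLocalDiffeomorphAt I I'' ∞ (g ∘ f) x :=
  hf.comp (hg := hg)

/-- A map is immersive at a point if it is smooth there with injective differential. -/
structure IsImmersiveAt (I : ModelWithCorners ℝ E A) (I' : ModelWithCorners ℝ E' A')
    (f : P → Q) (x : P) : Prop where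
  contMDiffAt : ContMDiffAt I I' ∞ f x
  injective_mfderiv : Function.Injective (mfderiv I I' f x)

theorem IsImmersiveAt.congr {f g : P → Q} {x : P} (hf : IsImmersiveAt I I' f x)
    (h : g =ᶠ[𝓝 x] f) : IsImmersiveAt I I' g x := by
  refine ⟨hf.contMDiffAt.congr_of_eventuallyEq h, ?_⟩
  have := hf.injective_mfderiv
  intro a b hab
  rw [h.mfderiv_eq] at hab
  exact this hab

theorem IsImmersiveAt.comp {f : P → Q} {g : Q → R} {x : P} (hg : IsImmersiveAt I' I'' g (f x))
    (hf : IsImmersiveAt I I' f x) : IsImmersiveAt I I'' (g ∘ f) x := by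
  refine ⟨hg.contMDiffAt.comp x hf.contMDiffAt, ?_⟩
  rw [mfderiv_comp x (hg.contMDiffAt.mdifferentiableAt (by simp))
    (hf.contMDiffAt.mdifferentiableAt (by simp))]
  exact hg.injective_mfderiv.comp hf.injective_mfderiv

theorem isImmersiveAt_of_isLocalDiffeomorphAt {f : P → Q} {x : P}
    (hf : IsLocalDiffeomorphAt I I' ∞ f x) : IsImmersiveAt I I' f x := by
  refine ⟨hf.contMDiffAt, ?_⟩
  have h := hf.mfderivToContinuousLinearEquiv_coe (by simp)
  rw [← h]
  exact (hf.mfderivToContinuousLinearEquiv (by simp)).injective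

theorem eventuallyEq_localInverse_comp {f : P → Q} {π : Q → R} {x : P}
    (hπ : IsLocalDiffeomorphAt I' I'' ∞ π (f x)) (hf : ContinuousAt f x) :
    f =ᶠ[𝓝 x] hπ.localInverse ∘ (π ∘ f) := by
  filter_upwards [hf.eventually hπ.localInverse_eventuallyEq_left] with y hy
  exact hy.symm

theorem eventuallyEq_comp_localInverse {R : Type*} {f : Q → R} {ι : P → Q} {x : P}
    (hι : IsLocalDiffeomorphAt I I' ∞ ι x) :
    f =ᶠ[𝓝 (ι x)] (f ∘ ι) ∘ hι.localInverse := by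
  filter_upwards [hι.localInverse_eventuallyEq_right] with y hy
  exact congrArg f hy.symm

theorem localInverse_apply_self {ι : P → Q} {x : P}
    (hι : IsLocalDiffeomorphAt I I' ∞ ι x) : hι.localInverse (ι x) = x :=
  hι.localInverse_left_inv hι.localInverse_mem_target

theorem isLocalDiffeomorphAt_of_comp_left {f : P → Q} {π : Q → R} {x : P}
    (h : IsLocalDiffeomorphAt I I'' ∞ (π ∘ f) x)
    (hπ : IsLocalDiffeomorphAt I' I'' ∞ π (f x)) (hf : ContinuousAt f x) :
    IsLocalDiffeomorphAt I I' ∞ f x :=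
  isLocalDiffeomorphAt_congr
    (isLocalDiffeomorphAt_comp (x := x) hπ.localInverse_isLocalDiffeomorphAt h)
    (eventuallyEq_localInverse_comp hπ hf)

theorem IsImmersiveAt.of_comp_left {f : P → Q} {π : Q → R} {x : P}
    (h : IsImmersiveAt I I'' (π ∘ f) x)
    (hπ : IsLocalDiffeomorphAt I' I'' ∞ π (f x)) (hf : ContinuousAt f x) :
    IsImmersiveAt I I' f x :=
  ((isImmersiveAt_of_isLocalDiffeomorphAt
    (x := (π ∘ f) x) hπ.localInverse_isLocalDiffeomorphAt).comp h).congr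
    (eventuallyEq_localInverse_comp hπ hf)

theorem isLocalDiffeomorphAt_of_comp_right {f : Q → R} {ι : P → Q} {x : P}
    (h : IsLocalDiffeomorphAt I I'' ∞ (f ∘ ι) x) (hι : IsLocalDiffeomorphAt I I' ∞ ι x) :
    IsLocalDiffeomorphAt I' I'' ∞ f (ι x) :=
  isLocalDiffeomorphAt_congr (isLocalDiffeomorphAt_comp (f := hι.localInverse)
    ((localInverse_apply_self hι).symm ▸ h) hι.localInverse_isLocalDiffeomorphAt)
    (eventuallyEq_comp_localInverse hι)

theorem IsImmersiveAt.of_comp_right {f : Q → R} {ι : P → Q} {x : P}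
    (h : IsImmersiveAt I I'' (f ∘ ι) x) (hι : IsLocalDiffeomorphAt I I' ∞ ι x) :
    IsImmersiveAt I' I'' f (ι x) :=
  (IsImmersiveAt.comp (f := hι.localInverse) ((localInverse_apply_self hι).symm ▸ h)
    (isImmersiveAt_of_isLocalDiffeomorphAt hι.localInverse_isLocalDiffeomorphAt)).congr
    (eventuallyEq_comp_localInverse hι)

theorem isLocalDiffeomorph_inl {P' : Type*} [TopologicalSpace P'] [ChartedSpace A P'] :
    IsLocalDiffeomorph I I ∞ (Sum.inl : P → P ⊕ P') := by
  intro x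
  refine ⟨{ toFun := Sum.inl
            invFun := Sum.elim id fun _ => x
            source := univ
            target := range Sum.inl
            map_source' := fun y _ => mem_range_self y
            map_target' := fun _ _ => mem_univ _
            left_inv' := fun _ _ => rfl
            right_inv' := by rintro _ ⟨y, rfl⟩; rfl
            open_source := isOpen_univ
            open_target := isOpen_range_inl
            contMDiffOn_toFun := ContMDiff.inl.contMDiffOn
            contMDiffOn_invFun := (contMDiff_id.sumElim contMDiff_const).contMDiffOn },
    mem_univ _, fun _ _ => rfl⟩

theorem isLocalDiffeomorph_inr {P' : Type*} [TopologicalSpace P'] [ChartedSpace A P'] :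
    IsLocalDiffeomorph I I ∞ (Sum.inr : P' → P ⊕ P') := by
  intro x
  refine ⟨{ toFun := Sum.inr
            invFun := Sum.elim (fun _ => x) id
            source := univ
            target := range Sum.inr
            map_source' := fun y _ => mem_range_self y
            map_target' := fun _ _ => mem_univ _
            left_inv' := fun _ _ => rfl
            right_inv' := by rintro _ ⟨y, rfl⟩; rfl
            open_source := isOpen_univ
            open_target := isOpen_range_inr
            contMDiffOn_toFun := ContMDiff.inr.contMDiffOn
            contMDiffOn_invFun := (contMDiff_const.sumElim contMDiff_id).contMDiffOn },
    mem_univ _, fun _ _ => rfl⟩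

theorem isLocalDiffeomorph_subtype_val (U : TopologicalSpace.Opens P) :
    IsLocalDiffeomorph I I ∞ (Subtype.val : U → P) := by
  classical
  intro x
  refine ⟨{ toFun := Subtype.val
            invFun := fun y => if h : y ∈ U then ⟨y, h⟩ else x
            source := univ
            target := U
            map_source' := fun y _ => y.2
            map_target' := fun _ _ => mem_univ _
            left_inv' := fun y _ => dif_pos y.2
            right_inv' := fun y hy => congrArg Subtype.val (dif_pos hy)
            open_source := isOpen_univ
            open_target := U.2
            contMDiffOn_toFun := contMDiff_subtype_val.contMDiffOn
            contMDiffOn_invFun := fun y hy => ContMDiffAt.contMDiffWithinAt ?_ },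
    mem_univ _, fun _ _ => rfl⟩
  refine (contMDiffAt_subtype_iff (x := (⟨y, hy⟩ : U))).mp ?_
  exact contMDiffAt_id.congr_of_eventuallyEq (.of_forall fun z => dif_pos z.2)

/-- The local identifications that define the smooth structure of `chartedSpaceOfLocal` are
diffeomorphisms onto their images. -/
theorem isLocalDiffeomorphAt_of_local {P : Type*} [TopologicalSpace P] {M : Type*}
    [TopologicalSpace M] [ChartedSpace A M] [IsManifold I ∞ M] {σ : P → OpenPartialHomeomorph P M}
    {hσ : ∀ p, p ∈ (σ p).source}
    (hc : ∀ p q, ContMDiffOn I I ∞ ((σ p).symm.trans (σ q)) ((σ p).symm.trans (σ q)).source)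
    (p : P) {x : P} (hx : x ∈ (σ p).source) :
    letI := chartedSpaceOfLocal (H := A) σ hσ
    IsLocalDiffeomorphAt I I ∞ (σ p) x := by
  let _ := chartedSpaceOfLocal (H := A) σ hσ
  exact ⟨{ toPartialEquiv := (σ p).toPartialEquiv
           open_source := (σ p).open_source
           open_target := (σ p).open_target
           contMDiffOn_toFun := (contMDiffOn_of_local (hσ := hσ) hc p).1
           contMDiffOn_invFun := (contMDiffOn_of_local (hσ := hσ) hc p).2 }, hx, fun _ _ => rfl⟩

end LocalDiffeo

/-! ### Homomorphisms out of `SK`-groups -/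

section Classes

variable {G : Type u} [Group G] {n : ℕ} {X : Type u} [TopologicalSpace X] [MulAction G X]

theorem cls_eq_of_isoOver {M M' : SingularGManifold G n X} (h : IsoOver M M') : M.cls = M'.cls :=
  congrArg (fun c => (QuotientAddGroup.mk (Algebra.GrothendieckAddGroup.of c) : SK G n X))
    (Quotient.sound h)

theorem cls_sum (M M' : SingularGManifold G n X) : (M.sum M').cls = M.cls + M'.cls := by
  have h : SingularClass.mk (M.sum M') = SingularClass.mk M + SingularClass.mk M' := rfl
  unfold SingularGManifold.cls
  rw [h, map_add, QuotientAddGroup.mk_add]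

theorem cls_eq_of_skOperation {M M' : SingularGManifold G n X} (h : SKOperation M M') :
    M.cls = M'.cls := by
  refine QuotientAddGroup.eq_iff_sub_mem.mpr (AddSubgroup.subset_closure ⟨M, M', h, rfl⟩)

/-- Classes of singular manifolds generate `SK^G(X)`. -/
theorem hom_ext_cls {A : Type*} [AddCommGroup A] {T T' : SK G n X →+ A}
    (h : ∀ M : SingularGManifold G n X, T M.cls = T' M.cls) : T = T' := by
  refine QuotientAddGroup.addMonoidHom_ext _ ?_
  refine Algebra.GrothendieckAddGroup.lift.symm.injective ?_
  refine AddMonoidHom.ext ?_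
  rintro ⟨M⟩
  exact h M

/-- The universal property of `SK^G(X)`: an invariant of singular manifolds that is additive under
disjoint unions and unchanged by `SK`-operations extends uniquely to a homomorphism. -/
theorem existsUnique_hom {A : Type*} [AddCommGroup A] (F : SingularGManifold G n X → A)
    (hiso : ∀ M M', IsoOver M M' → F M = F M') (hsum : ∀ M M', F (M.sum M') = F M + F M')
    (hSK : ∀ M M', SKOperation M M' → F M = F M') :
    ∃! T : SK G n X →+ A, ∀ M : SingularGManifold G n X, T M.cls = F M := by
  let f : SingularClass G n X → A := Quotient.lift F hiso
  have hadd : ∀ a b, f (a + b) = f a + f b := by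
    rintro ⟨M⟩ ⟨M'⟩
    exact hsum M M'
  let f' : SingularClass G n X →+ A :=
    { toFun := f
      map_add' := hadd
      map_zero' := by simpa using hadd 0 0 }
  have hf' : ∀ M, f' (SingularClass.mk M) = F M := fun _ => rfl
  let T₀ := Algebra.GrothendieckAddGroup.lift f'
  have hT₀ : ∀ a, T₀ (Algebra.GrothendieckAddGroup.of a) = f' a :=
    fun a => DFunLike.congr_fun (Algebra.GrothendieckAddGroup.lift.symm_apply_apply f') a
  have hker : skRelations G n X ≤ T₀.ker := by
    refine (AddSubgroup.closure_le _).mpr ?_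
    rintro _ ⟨M, M', h, rfl⟩
    change T₀ _ = 0
    rw [map_sub, hT₀, hT₀, hf', hf', hSK M M' h, sub_self]
  refine ⟨QuotientAddGroup.lift _ T₀ hker, fun M => ?_, fun T hT => hom_ext_cls fun M => ?_⟩
  · exact (hT₀ _).trans (hf' M)
  · exact (hT M).trans ((hT₀ _).trans (hf' M)).symm

/-- A bijective equivariant local diffeomorphism over `X` is an isomorphism over `X`. -/
theorem isoOver_of_bijective {M M' : SingularGManifold G n X} (f : M → M')
    (hf : Function.Bijective f) (hloc : IsLocalDiffeomorph (halfI n) (halfI n) ∞ f)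
    (hsmul : ∀ (g : G) (x : M), f (g • x) = g • f x) (href : ∀ x, M'.ref (f x) = M.ref x) :
    IsoOver M M' :=
  ⟨hloc.diffeomorphOfBijective hf, hsmul, href⟩

/-- Continuous equivariant maps over `X`. -/
structure OverMap (M M' : SingularGManifold G n X) where
  /-- the underlying map -/
  toFun : M → M'
  continuous : Continuous toFun
  map_smul : ∀ (g : G) (x : M), toFun (g • x) = g • toFun x
  ref_map : ∀ x, M'.ref (toFun x) = M.ref x

instance {M M' : SingularGManifold G n X} : CoeFun (OverMap M M') fun _ => M → M' :=
  ⟨OverMap.toFun⟩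

/-- The inclusion of the first summand of a disjoint union. -/
def OverMap.inl (M M' : SingularGManifold G n X) : OverMap M (M.sum M') where
  toFun := Sum.inl
  continuous := continuous_inl
  map_smul _ _ := rfl
  ref_map _ := rfl

/-- The inclusion of the second summand of a disjoint union. -/
def OverMap.inr (M M' : SingularGManifold G n X) : OverMap M' (M.sum M') where
  toFun := Sum.inr
  continuous := continuous_inr
  map_smul _ _ := rfl
  ref_map _ := rfl

/-- A `G`-manifold with a `G`-map to a singular manifold is a singular manifold. -/
def GManifold.over (N : GManifold G n) (M : SingularGManifold G n X)
    (j : N → M) (hj : Continuous j) (hsmul : ∀ (g : G) (x : N), j (g • x) = g • j x) :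
    SingularGManifold G n X where
  toGManifold := N
  ref := M.ref ∘ j
  continuous_ref := M.continuous_ref.comp hj
  ref_smul g x := (congrArg M.ref (hsmul g x)).trans (M.ref_smul g (j x))

/-- A homotopy into a discrete space is constant. -/
theorem GHomotopic.eq {A : Type u} [TopologicalSpace A] [MulAction G A]
    [DiscreteTopology X] {f f' : A → X} (h : GHomotopic G f f') : f = f' := by
  obtain ⟨K, hK, h0, h1, -⟩ := h
  funext a
  rw [← h0, ← h1]
  exact PreconnectedSpace.constant inferInstance
    (hK.comp (continuous_id.prodMk continuous_const) : Continuous fun t : unitInterval => K (t, a))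

theorem GHomotopic.refl {A : Type u} [TopologicalSpace A] [MulAction G A]
    {f : A → X} (hf : Continuous f) (hsmul : ∀ (g : G) (a : A), f (g • a) = g • f a) :
    GHomotopic G f f :=
  ⟨fun p => f p.2, hf.comp continuous_snd, fun _ => rfl, fun _ => rfl, fun g _ a => hsmul g a⟩

end Classes

/-! ### Geometric constructions -/

section Construction

variable {G : Type u} [Group G] {G' : Type u} [Group G'] {n : ℕ}
  {X : Type u} [TopologicalSpace X] [MulAction G X]
  {Y : Type u} [TopologicalSpace Y] [MulAction G' Y]

/-- A construction that turns singular `G`-manifolds in `X` into singular `G'`-manifolds in `Y`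
whose points locally look like those of the original manifold: every point of `F M` has an
underlying point of `M`, and maps over `X` induce maps over `Y` that behave, up to the action of
`G`, like the original ones on underlying points. -/
structure LocalConstruction (F : SingularGManifold G n X → SingularGManifold G' n Y) where
  /-- the induced map -/
  map : ∀ {M M' : SingularGManifold G n X}, OverMap M M' → OverMap (F M) (F M')
  /-- the underlying point -/
  pt : ∀ {M : SingularGManifold G n X}, F M → M
  exists_pt_map : ∀ {M M' : SingularGManifold G n X} (j : OverMap M M') (p : F M),
    ∃ g : G, pt (map j p) = g • j (pt p)
  isBoundaryPoint_iff : ∀ {M : SingularGManifold G n X} (p : F M),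
    (halfI n).IsBoundaryPoint p ↔ (halfI n).IsBoundaryPoint (pt p)
  map_injective : ∀ {M M' : SingularGManifold G n X} (j : OverMap M M'),
    Function.Injective j → Function.Injective (map j)
  mem_range_map : ∀ {M M' : SingularGManifold G n X} (j : OverMap M M') (q : F M'),
    pt q ∈ range j → q ∈ range (map j)
  isLocalDiffeomorphAt_map : ∀ {M M' : SingularGManifold G n X} (j : OverMap M M') (p : F M),
    IsLocalDiffeomorphAt (halfI n) (halfI n) ∞ j (pt p) →
      IsLocalDiffeomorphAt (halfI n) (halfI n) ∞ (map j) p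
  isImmersiveAt_map : ∀ {M M' : SingularGManifold G n X} (j : OverMap M M') (p : F M),
    IsImmersiveAt (halfI n) (halfI n) j (pt p) → IsImmersiveAt (halfI n) (halfI n) (map j) p

namespace LocalConstruction

variable {F : SingularGManifold G n X → SingularGManifold G' n Y} (C : LocalConstruction F)
  {M M' : SingularGManifold G n X}

theorem pt_map_mem_iff (j : OverMap M M') {S : Set M'} (hS : ∀ (g : G), ∀ x ∈ S, g • x ∈ S)
    (p : F M) : C.pt (C.map j p) ∈ S ↔ j (C.pt p) ∈ S := by
  obtain ⟨g, hg⟩ := C.exists_pt_map j p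
  rw [hg]
  refine ⟨fun h => ?_, hS g _⟩
  simpa using hS g⁻¹ _ h

theorem smul_mem_range (j : OverMap M M') (g : G) (x : M') (hx : x ∈ range j) :
    g • x ∈ range j := by
  obtain ⟨y, rfl⟩ := hx
  exact ⟨g • y, j.map_smul g y⟩

/-- Ranges of induced maps are the sets of points over the ranges of the original maps. Underlying
points are only natural up to the action of `G`, which is harmless because ranges of equivariant
maps are invariant. -/
theorem range_map (j : OverMap M M') : range (C.map j) = C.pt ⁻¹' range j := by
  ext q
  refine ⟨?_, C.mem_range_map j q⟩
  rintro ⟨p, rfl⟩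
  exact (C.pt_map_mem_iff j (smul_mem_range j) p).mpr (mem_range_self _)

theorem image_map (j : OverMap M M') (hj : Function.Injective j) {S : Set M} {T : Set M'}
    (hS : T = j '' S) (hT : ∀ (g : G), ∀ x ∈ T, g • x ∈ T) :
    C.map j '' (C.pt ⁻¹' S) = C.pt ⁻¹' T := by
  subst hS
  ext q
  constructor
  · rintro ⟨p, hp, rfl⟩
    exact (C.pt_map_mem_iff j hT p).mpr (mem_image_of_mem j hp)
  · intro hq
    obtain ⟨p, rfl⟩ := C.mem_range_map j q (image_subset_range _ _ hq)
    exact mem_image_of_mem _ ((hj.mem_set_image).mp ((C.pt_map_mem_iff j hT p).mp hq))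

theorem isLocalDiffeomorph_map (j : OverMap M M')
    (hj : IsLocalDiffeomorph (halfI n) (halfI n) ∞ j) :
    IsLocalDiffeomorph (halfI n) (halfI n) ∞ (C.map j) :=
  fun p => C.isLocalDiffeomorphAt_map j p (hj _)

include C in
theorem isoOver (h : IsoOver M M') : IsoOver (F M) (F M') := by
  obtain ⟨φ, h1, h2⟩ := h
  let j : OverMap M M' := ⟨φ, φ.continuous, h1, h2⟩
  refine isoOver_of_bijective (C.map j) ⟨C.map_injective j φ.injective, ?_⟩
    (C.isLocalDiffeomorph_map j φ.isLocalDiffeomorph) (C.map j).map_smul (C.map j).ref_map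
  rw [← range_eq_univ, C.range_map]
  exact eq_univ_of_forall fun q => φ.surjective _

include C in
theorem isoOver_sum (M M' : SingularGManifold G n X) :
    IsoOver ((F M).sum (F M')) (F (M.sum M')) := by
  let i₁ := C.map (OverMap.inl M M')
  let i₂ := C.map (OverMap.inr M M')
  have r₁ : range i₁ = C.pt ⁻¹' range Sum.inl := C.range_map _
  have r₂ : range i₂ = C.pt ⁻¹' range Sum.inr := C.range_map _
  have h₁ := C.isLocalDiffeomorph_map (OverMap.inl M M') isLocalDiffeomorph_inl
  have h₂ := C.isLocalDiffeomorph_map (OverMap.inr M M') isLocalDiffeomorph_inr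
  refine isoOver_of_bijective (Sum.elim i₁ i₂ : F M ⊕ F M' → F (M.sum M')) ⟨?_, ?_⟩ ?_ ?_ ?_
  · refine (C.map_injective _ Sum.inl_injective).sumElim (C.map_injective _ Sum.inr_injective) ?_
    intro a b hab
    obtain ⟨x, hx⟩ : C.pt (i₁ a) ∈ range Sum.inl := r₁.subset (mem_range_self a)
    obtain ⟨y, hy⟩ : C.pt (i₁ a) ∈ range Sum.inr := r₂.subset ⟨b, hab.symm⟩
    exact Sum.inl_ne_inr (hx.trans hy.symm)
  · intro q
    have hq : q ∈ range i₁ ∪ range i₂ := by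
      rw [r₁, r₂]
      exact range_inl_union_range_inr.superset (mem_univ (C.pt q))
    obtain ⟨a, ha⟩ | ⟨b, hb⟩ := hq
    · exact ⟨.inl a, ha⟩
    · exact ⟨.inr b, hb⟩
  · rintro (a | b)
    · exact isLocalDiffeomorphAt_of_comp_right (f := Sum.elim i₁ i₂) (ι := Sum.inl) (h₁ a)
        (isLocalDiffeomorph_inl a)
    · exact isLocalDiffeomorphAt_of_comp_right (f := Sum.elim i₁ i₂) (ι := Sum.inr) (h₂ b)
        (isLocalDiffeomorph_inr b)
  · rintro g (a | b)
    · exact i₁.map_smul g a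
    · exact i₂.map_smul g b
  · rintro (a | b)
    · exact i₁.ref_map a
    · exact i₂.ref_map b

theorem isGEmbedding_map (j : OverMap M M')
    (hj : IsGEmbedding (N := M.toGManifold) (M := M'.toGManifold) j) :
    IsGEmbedding (N := (F M).toGManifold) (M := (F M').toGManifold) (C.map j) := by
  have h := fun p => C.isImmersiveAt_map j p ⟨hj.contMDiff _, hj.injective_mfderiv _⟩
  exact ⟨fun p => (h p).contMDiffAt, fun p => (h p).injective_mfderiv,
    ((C.map j).continuous.isClosedEmbedding
      (C.map_injective j hj.isEmbedding.injective)).isEmbedding, (C.map j).map_smul⟩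

/-- Pastings over `X` are turned into pastings. -/
theorem isPasting_map {M₁ M₂ : SingularGManifold G n X} {S₁ : Set M₁} {S₂ : Set M₂}
    (j₁ : OverMap M₁ M) (j₂ : OverMap M₂ M)
    (h : IsPasting M₁.toGManifold M₂.toGManifold S₁ S₂ M.toGManifold j₁ j₂) :
    IsPasting (F M₁).toGManifold (F M₂).toGManifold (C.pt ⁻¹' S₁) (C.pt ⁻¹' S₂) (F M).toGManifold
      (C.map j₁) (C.map j₂) := by
  have hinv : ∀ (g : G), ∀ x ∈ range j₁ ∩ range j₂, g • x ∈ range j₁ ∩ range j₂ :=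
    fun g x hx => ⟨smul_mem_range j₁ g x hx.1, smul_mem_range j₂ g x hx.2⟩
  have hr : range (C.map j₁) ∩ range (C.map j₂) = C.pt ⁻¹' (range j₁ ∩ range j₂) := by
    rw [C.range_map, C.range_map, preimage_inter]
  refine ⟨C.isGEmbedding_map j₁ h.embedding₁, C.isGEmbedding_map j₂ h.embedding₂,
    fun p hp => (C.isBoundaryPoint_iff p).mpr (h.subset_boundary₁ hp),
    fun p hp => (C.isBoundaryPoint_iff p).mpr (h.subset_boundary₂ hp), ?_, ?_, ?_, ?_⟩
  · rw [C.range_map, C.range_map, ← preimage_union, h.range_union, preimage_univ]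
  · exact hr.trans (C.image_map j₁ h.embedding₁.isEmbedding.injective h.range_inter₁ hinv).symm
  · exact hr.trans (C.image_map j₂ h.embedding₂.isEmbedding.injective h.range_inter₂ hinv).symm
  · rw [hr]
    refine disjoint_left.mpr fun q hq hq' => ?_
    exact disjoint_left.mp h.disjoint_boundary hq ((C.isBoundaryPoint_iff q).mp hq')

include C in
/-- If `X` is discrete, `G`-homotopic maps to `X` are equal. Hence the pieces of an `SK`-operation
are singular manifolds in `X`, and the construction applies to the whole operation. -/
theorem skOperation [DiscreteTopology X] (h : SKOperation M M') : SKOperation (F M) (F M') := by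
  obtain ⟨M₁, M₂, S₁, S₂, j₁, j₂, j₁', j₂', hp, hp', h₁, h₂⟩ := h
  let N₁ := M₁.over M j₁ hp.embedding₁.contMDiff.continuous hp.embedding₁.map_smul
  let N₂ := M₂.over M j₂ hp.embedding₂.contMDiff.continuous hp.embedding₂.map_smul
  let k₁ : OverMap N₁ M :=
    ⟨j₁, hp.embedding₁.contMDiff.continuous, hp.embedding₁.map_smul, fun _ => rfl⟩
  let k₂ : OverMap N₂ M :=
    ⟨j₂, hp.embedding₂.contMDiff.continuous, hp.embedding₂.map_smul, fun _ => rfl⟩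
  let k₁' : OverMap N₁ M' := ⟨j₁', hp'.embedding₁.contMDiff.continuous, hp'.embedding₁.map_smul,
    fun x => (congrFun h₁.eq x).symm⟩
  let k₂' : OverMap N₂ M' := ⟨j₂', hp'.embedding₂.contMDiff.continuous, hp'.embedding₂.map_smul,
    fun x => (congrFun h₂.eq x).symm⟩
  have e : ∀ {N : SingularGManifold G n X} (k : OverMap N M) (k' : OverMap N M'),
      GHomotopic G' ((F M).ref ∘ C.map k) ((F M').ref ∘ C.map k') := by
    intro N k k'
    have e₁ : (F M).ref ∘ C.map k = (F N).ref := funext (C.map k).ref_map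
    have e₂ : (F M').ref ∘ C.map k' = (F N).ref := funext (C.map k').ref_map
    rw [e₁, e₂]
    exact GHomotopic.refl (F N).continuous_ref (F N).ref_smul
  exact ⟨(F N₁).toGManifold, (F N₂).toGManifold, C.pt ⁻¹' S₁, C.pt ⁻¹' S₂, C.map k₁, C.map k₂,
    C.map k₁', C.map k₂', C.isPasting_map (M₁ := N₁) (M₂ := N₂) k₁ k₂ hp,
    C.isPasting_map (M₁ := N₁) (M₂ := N₂) k₁' k₂' hp', e k₁ k₁', e k₂ k₂'⟩

include C in
theorem existsUnique_hom [DiscreteTopology X] :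
    ∃! T : SK G n X →+ SK G' n Y, ∀ M : SingularGManifold G n X, T M.cls = (F M).cls :=
  EquivariantSK.existsUnique_hom (fun M => (F M).cls)
    (fun _ _ h => cls_eq_of_isoOver (C.isoOver h))
    (fun M M' => (cls_eq_of_isoOver (C.isoOver_sum M M')).symm.trans (cls_sum _ _))
    (fun _ _ h => cls_eq_of_skOperation (C.skOperation h))

/-- The same construction on manifolds with other reference maps. -/
def changeRef {Z : Type u} [TopologicalSpace Z] [MulAction G' Z]
    (r : ∀ M : SingularGManifold G n X, F M → Z) (hr : ∀ M, Continuous (r M))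
    (hsmul : ∀ M (g : G') (p : F M), r M (g • p) = g • r M p)
    (hmap : ∀ {M M' : SingularGManifold G n X} (j : OverMap M M') (p : F M),
      r M' (C.map j p) = r M p) :
    LocalConstruction fun M : SingularGManifold G n X =>
      ({ toGManifold := (F M).toGManifold
         ref := r M
         continuous_ref := hr M
         ref_smul := hsmul M } : SingularGManifold G' n Z) where
  map j := ⟨C.map j, (C.map j).continuous, (C.map j).map_smul, hmap j⟩
  pt := C.pt
  exists_pt_map := C.exists_pt_map
  isBoundaryPoint_iff := C.isBoundaryPoint_iff
  map_injective := C.map_injective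
  mem_range_map := C.mem_range_map
  isLocalDiffeomorphAt_map := C.isLocalDiffeomorphAt_map
  isImmersiveAt_map := C.isImmersiveAt_map

end LocalConstruction

end Construction

/-- Translation by a group element as a diffeomorphism. -/
def GManifold.smulDiffeomorph {G : Type u} [Group G] {n : ℕ} (M : GManifold G n) (g : G) :
    Diffeomorph (halfI n) (halfI n) M M ∞ where
  toEquiv := MulAction.toPerm g
  contMDiff_toFun := M.contMDiff_smul g
  contMDiff_invFun := M.contMDiff_smul g⁻¹

theorem GManifold.isLocalDiffeomorph_smul {G : Type u} [Group G] {n : ℕ} (M : GManifold G n)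
    (g : G) : IsLocalDiffeomorph (halfI n) (halfI n) ∞ fun x : M => g • x :=
  (M.smulDiffeomorph g).isLocalDiffeomorph

/-! ### Restriction along a homomorphism -/

section Restrict

variable {H K : Type u} [Group H] [Group K] {n : ℕ}

/-- Restriction of actions along a homomorphism, as a construction on manifolds. -/
def restrictConstruction (φ : K →* H) : LocalConstruction
    fun M : SingularGManifold H n PUnit.{u + 1} => (M.toGManifold.restrict φ).toPoint where
  map j := ⟨j.toFun, j.continuous, fun k x => j.map_smul (φ k) x, fun _ => rfl⟩
  pt p := p
  exists_pt_map _ _ := ⟨1, (one_smul _ _).symm⟩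
  isBoundaryPoint_iff _ := Iff.rfl
  map_injective _ hj := hj
  mem_range_map _ _ hq := hq
  isLocalDiffeomorphAt_map _ _ h := h
  isImmersiveAt_map _ _ h := h

end Restrict

/-! ### Fibres -/

section Fibre

variable {G : Type u} [Group G] [TopologicalSpace G] [DiscreteTopology G] {n : ℕ} {H : Subgroup G}

/-- The inclusion of the fibre over the trivial coset. -/
def SingularGManifold.fibreVal (M : SingularGManifold G n (G ⧸ H)) (x : M.fibre) : M :=
  Subtype.val x

theorem SingularGManifold.ref_fibreVal (M : SingularGManifold G n (G ⧸ H)) (x : M.fibre) :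
    M.ref (M.fibreVal x) = ((1 : G) : G ⧸ H) :=
  Subtype.prop x

/-- A point over the trivial coset, as a point of the fibre. -/
def SingularGManifold.fibreMk (M : SingularGManifold G n (G ⧸ H)) (x : M)
    (hx : M.ref x = ((1 : G) : G ⧸ H)) : M.fibre :=
  Subtype.mk x hx

theorem SingularGManifold.fibreVal_injective (M : SingularGManifold G n (G ⧸ H)) :
    Function.Injective M.fibreVal :=
  Subtype.val_injective

theorem SingularGManifold.fibreVal_smul (M : SingularGManifold G n (G ⧸ H)) (h : H) (x : M.fibre) :
    M.fibreVal (h • x) = (h : G) • M.fibreVal x :=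
  rfl

theorem SingularGManifold.continuous_fibre_iff (M : SingularGManifold G n (G ⧸ H)) {A : Type*}
    [TopologicalSpace A] {f : A → M.fibre} : Continuous f ↔ Continuous (M.fibreVal ∘ f) :=
  Topology.IsInducing.subtypeVal.continuous_iff

theorem SingularGManifold.isLocalDiffeomorph_fibreVal (M : SingularGManifold G n (G ⧸ H)) :
    IsLocalDiffeomorph (halfI n) (halfI n) ∞ M.fibreVal :=
  isLocalDiffeomorph_subtype_val _

variable {M M' : SingularGManifold G n (G ⧸ H)}

/-- The map of fibres induced by a map over `G/H`. -/
def OverMap.fibre (j : OverMap M M') : OverMap M.fibre.toPoint M'.fibre.toPoint where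
  toFun x := M'.fibreMk (j (M.fibreVal x)) ((j.ref_map _).trans (M.ref_fibreVal x))
  continuous := M'.continuous_fibre_iff.mpr
    (j.continuous.comp M.isLocalDiffeomorph_fibreVal.contMDiff.continuous)
  map_smul h x := M'.fibreVal_injective (j.map_smul (h : G) (M.fibreVal x))
  ref_map _ := rfl

/-- Taking the fibre over the trivial coset, as a construction on manifolds. -/
def fibreConstruction (H : Subgroup G) : LocalConstruction
    fun M : SingularGManifold G n (G ⧸ H) => M.fibre.toPoint where
  map j := j.fibre
  pt {M} := M.fibreVal
  exists_pt_map _ _ := ⟨1, (one_smul _ _).symm⟩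
  isBoundaryPoint_iff {M} p := (M.isLocalDiffeomorph_fibreVal p).isBoundaryPoint_iff (by simp)
  map_injective {M M'} j hj p q hpq :=
    M.fibreVal_injective (hj (congrArg M'.fibreVal hpq))
  mem_range_map {M M'} j q hq := by
    obtain ⟨x, hx⟩ := hq
    exact ⟨M.fibreMk x (by rw [← j.ref_map, hx]; exact M'.ref_fibreVal q),
      M'.fibreVal_injective hx⟩
  isLocalDiffeomorphAt_map {M M'} j p h :=
    isLocalDiffeomorphAt_of_comp_left (π := M'.fibreVal)
      (isLocalDiffeomorphAt_comp (g := j.toFun) (f := M.fibreVal) h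
        (M.isLocalDiffeomorph_fibreVal p))
      (M'.isLocalDiffeomorph_fibreVal _) j.fibre.continuous.continuousAt
  isImmersiveAt_map {M M'} j p h :=
    IsImmersiveAt.of_comp_left (π := M'.fibreVal)
      (h.comp (isImmersiveAt_of_isLocalDiffeomorphAt (M.isLocalDiffeomorph_fibreVal p)))
      (M'.isLocalDiffeomorph_fibreVal _) j.fibre.continuous.continuousAt

end Fibre

/-! ### Spans -/

section Span

variable {G : Type u} [Group G] {n : ℕ}
  {X : Type u} [TopologicalSpace X] [DiscreteTopology X] [MulAction G X]
  {U : Type u} [TopologicalSpace U] [DiscreteTopology U] [Finite U] [MulAction G U]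
  {Y : Type u} [TopologicalSpace Y] [MulAction G Y]
  (α : U →[G] X) (β : U →[G] Y) (M : SingularGManifold G n X)

/-- The projection `M ×_X U → M`. -/
def SingularGManifold.spanFst (p : M.span α β) : M :=
  Prod.fst (Subtype.val (p := fun q : M × U => M.ref q.1 = α q.2) p)

/-- The projection `M ×_X U → U`. -/
def SingularGManifold.spanSnd (p : M.span α β) : U :=
  Prod.snd (Subtype.val (p := fun q : M × U => M.ref q.1 = α q.2) p)

/-- The point `(x, u)` of `M ×_X U`. -/
def SingularGManifold.spanMk (x : M) (u : U) (h : M.ref x = α u) : M.span α β :=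
  (⟨(x, u), h⟩ : M.ref.Pullback α)

namespace SingularGManifold

variable {α β M}

theorem ref_spanFst (p : M.span α β) : M.ref (M.spanFst α β p) = α (M.spanSnd α β p) :=
  Subtype.property (p := fun q : M × U => M.ref q.1 = α q.2) p

theorem ref_span (p : M.span α β) : (M.span α β).ref p = β (M.spanSnd α β p) := rfl

theorem span_ext {p q : M.span α β} (h₁ : M.spanFst α β p = M.spanFst α β q)
    (h₂ : M.spanSnd α β p = M.spanSnd α β q) : p = q :=
  Subtype.ext (p := fun q : M × U => M.ref q.1 = α q.2) (Prod.ext h₁ h₂)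

/-- Points of the pullback along an injective map are determined by their projections to `M`. -/
theorem spanFst_injective (hα : Function.Injective α) :
    Function.Injective (M.spanFst α β) := fun p q hpq =>
  span_ext hpq (hα ((ref_spanFst p).symm.trans ((congrArg M.ref hpq).trans (ref_spanFst q))))

theorem continuous_spanSnd : Continuous (M.spanSnd α β) :=
  continuous_snd.comp continuous_subtype_val

theorem isLocalDiffeomorph_spanFst :
    IsLocalDiffeomorph (halfI n) (halfI n) ∞ (M.spanFst α β) :=
  fun p => isLocalDiffeomorphAt_of_local (I := halfI n) (pullbackChart_compat M α)
    (σ := pullbackChart M α) (hσ := fun _ => rfl) p rfl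

theorem continuous_spanFst : Continuous (M.spanFst α β) :=
  isLocalDiffeomorph_spanFst.contMDiff.continuous

theorem continuous_span {A : Type*} [TopologicalSpace A] {f : A → M.span α β}
    (h₁ : Continuous (M.spanFst α β ∘ f)) (h₂ : Continuous (M.spanSnd α β ∘ f)) : Continuous f :=
  (Topology.IsInducing.subtypeVal
    (t := {q : M × U | M.ref q.1 = α q.2})).continuous_iff.mpr (h₁.prodMk h₂)

end SingularGManifold

open SingularGManifold

variable {M} {M' : SingularGManifold G n X}

/-- The map of pullbacks induced by a map over `X`. -/
def OverMap.span (j : OverMap M M') : OverMap (M.span α β) (M'.span α β) where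
  toFun p := M'.spanMk α β (j (M.spanFst α β p)) (M.spanSnd α β p)
    ((j.ref_map _).trans (ref_spanFst p))
  continuous := continuous_span (j.continuous.comp continuous_spanFst) continuous_spanSnd
  map_smul g _ := span_ext (j.map_smul g _) rfl
  ref_map _ := rfl

/-- The value of a span of finite `G`-sets, as a construction on manifolds. -/
def spanConstruction : LocalConstruction
    fun M : SingularGManifold G n X => M.span α β where
  map j := j.span α β
  pt {M} := M.spanFst α β
  exists_pt_map _ _ := ⟨1, (one_smul _ _).symm⟩
  isBoundaryPoint_iff {M} p := (isLocalDiffeomorph_spanFst p).isBoundaryPoint_iff (by simp)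
  map_injective {M M'} j hj _ _ hpq := span_ext (hj (congrArg (M'.spanFst α β) hpq))
    (congrArg (M'.spanSnd α β) hpq)
  mem_range_map {M M'} j q hq := by
    obtain ⟨x, hx⟩ := hq
    exact ⟨M.spanMk α β x (M'.spanSnd α β q) (by rw [← j.ref_map, hx, ref_spanFst]),
      span_ext hx rfl⟩
  isLocalDiffeomorphAt_map {M M'} j p h :=
    isLocalDiffeomorphAt_of_comp_left (π := M'.spanFst α β)
      (isLocalDiffeomorphAt_comp (g := j.toFun) (f := M.spanFst α β) h
        (isLocalDiffeomorph_spanFst p))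
      (isLocalDiffeomorph_spanFst _) (j.span α β).continuous.continuousAt
  isImmersiveAt_map {M M'} j p h :=
    IsImmersiveAt.of_comp_left (π := M'.spanFst α β)
      (h.comp (isImmersiveAt_of_isLocalDiffeomorphAt (isLocalDiffeomorph_spanFst p)))
      (isLocalDiffeomorph_spanFst _) (j.span α β).continuous.continuousAt

end Span

/-! ### Induction -/

section Induction

variable {H K : Type u} [Group H] [Group K] [Finite H] [TopologicalSpace H] [DiscreteTopology H]
  {n : ℕ} {φ : K →* H} (hφ : Function.Injective φ)

/-- The map `N → H ×_K N`, `x ↦ [h, x]`. -/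
def GManifold.induceMk (N : GManifold K n) (h : H) (x : N) : N.induce φ hφ :=
  BalancedProduct.mk φ N h x

variable {hφ} {N : GManifold K n}

theorem GManifold.induceMk_eq_iff {h h' : H} {x x' : N} :
    N.induceMk hφ h x = N.induceMk hφ h' x' ↔ ∃ k : K, h' * (φ k)⁻¹ = h ∧ k • x' = x :=
  BalancedProduct.mk_eq_iff

theorem GManifold.exists_induceMk (q : N.induce φ hφ) :
    ∃ p : H × N, N.induceMk hφ p.1 p.2 = q :=
  BalancedProduct.exists_mk q

theorem GManifold.isLocalDiffeomorph_induceMk (h : H) :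
    IsLocalDiffeomorph (halfI n) (halfI n) ∞ (N.induceMk hφ h) := by
  intro x
  let q : BalancedProduct φ N := BalancedProduct.mk φ N h x
  let _ : ChartedSpace (HalfModel n) (BalancedProduct φ N) :=
    chartedSpaceOfLocal (BalancedProduct.chartAt' hφ) (BalancedProduct.mem_chartAt'_source hφ)
  -- If `[h, x] = [h', x']` with `h' = h * φ(k)⁻¹`, then `[h, y] = [h', ky]` for all `y`. So in the
  -- coordinate at `[h, x]` given by the representative `(h', x')`, the map is `y ↦ ky`.
  obtain ⟨k, hk, -⟩ := BalancedProduct.mk_eq_iff.mp (BalancedProduct.exists_mk q).choose_spec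
  refine isLocalDiffeomorphAt_of_comp_left (π := BalancedProduct.chartAt' hφ q) ?_
    (isLocalDiffeomorphAt_of_local (I := halfI n) (BalancedProduct.compat hφ)
      (hσ := BalancedProduct.mem_chartAt'_source hφ) q
      (BalancedProduct.mem_chartAt'_source hφ q))
    (BalancedProduct.continuous_mk h).continuousAt
  refine isLocalDiffeomorphAt_congr (N.isLocalDiffeomorph_smul k x) (.of_forall fun y => ?_)
  have hy : BalancedProduct.mk φ N h y =
      BalancedProduct.mk φ N (BalancedProduct.exists_mk q).choose.1 (k • y) :=
    (BalancedProduct.mk_eq_iff.mpr ⟨k, hk, rfl⟩).symm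
  change BalancedProduct.chartAt' hφ q (BalancedProduct.mk φ N h y) = k • y
  rw [hy]
  exact BalancedProduct.chart_mk hφ _ _ _

open GManifold

variable (hφ) {M M' : SingularGManifold K n PUnit.{u + 1}}

/-- The map `H ×_K M → H ×_K M'` induced by a `K`-map `M → M'`. -/
def OverMap.induce (j : OverMap M M') :
    OverMap (M.toGManifold.induce φ hφ).toPoint
      (M'.toGManifold.induce φ hφ).toPoint where
  toFun := Quotient.lift
    (fun p : BalancedPre φ M.toGManifold => M'.toGManifold.induceMk hφ p.1 (j p.2)) (by
      rintro _ p ⟨k, rfl⟩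
      exact induceMk_eq_iff.mpr ⟨k, rfl, (j.map_smul k p.2).symm⟩)
  continuous := continuous_quot_lift _ (continuous_quotient_mk'.comp
    (continuous_fst.prodMk (j.continuous.comp continuous_snd)))
  map_smul := by
    rintro g ⟨p⟩
    rfl
  ref_map _ := rfl

theorem OverMap.induce_induceMk (j : OverMap M M') (h : H) (x : M) :
    j.induce hφ (M.toGManifold.induceMk hφ h x) = M'.toGManifold.induceMk hφ h (j x) := rfl

/-- Induction along `φ : K → H`, as a construction on manifolds. The underlying point of `[h, x]` is
the second coordinate of a chosen representative, so that it is determined up to the action of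
`K`. -/
noncomputable def induceConstruction : LocalConstruction
    fun M : SingularGManifold K n PUnit.{u + 1} => (M.toGManifold.induce φ hφ).toPoint where
  map j := j.induce hφ
  pt q := (exists_induceMk q).choose.2
  exists_pt_map {M M'} j p := by
    have h₁ := (exists_induceMk p).choose_spec
    have h₂ := (exists_induceMk (j.induce hφ p)).choose_spec
    conv_rhs at h₂ => rw [← h₁]
    obtain ⟨k, -, hk⟩ := induceMk_eq_iff.mp (h₂.trans (j.induce_induceMk hφ _ _))
    exact ⟨k, hk.symm⟩
  isBoundaryPoint_iff {M} p := by
    have h := (isLocalDiffeomorph_induceMk (hφ := hφ) (exists_induceMk p).choose.1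
      (exists_induceMk p).choose.2).isBoundaryPoint_iff (by simp)
    rw [(exists_induceMk p).choose_spec] at h
    exact h.symm
  map_injective {M M'} j hj p q hpq := by
    obtain ⟨⟨g, x⟩, rfl⟩ := exists_induceMk p
    obtain ⟨⟨g', x'⟩, rfl⟩ := exists_induceMk q
    obtain ⟨k, hk, hk'⟩ := induceMk_eq_iff.mp hpq
    exact induceMk_eq_iff.mpr ⟨k, hk, hj ((j.map_smul k x').trans hk')⟩
  mem_range_map {M M'} j q hq := by
    obtain ⟨x, hx⟩ := hq
    refine ⟨M.toGManifold.induceMk hφ (exists_induceMk q).choose.1 x, ?_⟩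
    rw [j.induce_induceMk hφ, hx]
    exact (exists_induceMk q).choose_spec
  isLocalDiffeomorphAt_map {M M'} j p h := by
    have := isLocalDiffeomorphAt_of_comp_right (f := j.induce hφ)
      (isLocalDiffeomorphAt_comp (f := j.toFun)
        (isLocalDiffeomorph_induceMk (hφ := hφ) (exists_induceMk p).choose.1 _) h)
      (isLocalDiffeomorph_induceMk (hφ := hφ) (exists_induceMk p).choose.1 _)
    rwa [(exists_induceMk p).choose_spec] at this
  isImmersiveAt_map {M M'} j p h := by
    have := IsImmersiveAt.of_comp_right (f := j.induce hφ)
      ((isImmersiveAt_of_isLocalDiffeomorphAt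
        (isLocalDiffeomorph_induceMk (hφ := hφ) (exists_induceMk p).choose.1 _)).comp h)
      (isLocalDiffeomorph_induceMk (hφ := hφ) (exists_induceMk p).choose.1 _)
    rwa [(exists_induceMk p).choose_spec] at this

end Induction

section InduceOver

variable {G : Type u} [Group G] [Finite G] [TopologicalSpace G] [DiscreteTopology G] {n : ℕ}
  (L : Subgroup G)

/-- The map `N → G ×_L N`, `x ↦ [g, x]`. -/
def GManifold.overMk (N : GManifold L n) (g : G) (x : N) : N.induceOver L :=
  N.induceMk L.subtype_injective g x

namespace GManifold

variable {L} {N : GManifold L n}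

theorem overMk_eq_iff {g g' : G} {x x' : N} :
    N.overMk L g x = N.overMk L g' x' ↔ ∃ k : L, g' * (k : G)⁻¹ = g ∧ k • x' = x :=
  BalancedProduct.mk_eq_iff

theorem ref_overMk (g : G) (x : N) : (N.induceOver L).ref (N.overMk L g x) = (g : G ⧸ L) := rfl

theorem exists_overMk (q : N.induceOver L) : ∃ p : G × N, N.overMk L p.1 p.2 = q :=
  BalancedProduct.exists_mk q

theorem isLocalDiffeomorph_overMk (g : G) :
    IsLocalDiffeomorph (halfI n) (halfI n) ∞ (N.overMk L g) :=
  isLocalDiffeomorph_induceMk (hφ := L.subtype_injective) g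

end GManifold

/-- Induction from `L` to `G`, with the projection to `G/L`, as a construction on manifolds. -/
noncomputable def induceOverConstruction : LocalConstruction
    fun M : SingularGManifold L n PUnit.{u + 1} => M.toGManifold.induceOver L :=
  (induceConstruction L.subtype_injective).changeRef
    (fun M => (M.toGManifold.induceOver L).ref)
    (fun M => (M.toGManifold.induceOver L).continuous_ref)
    (fun M => (M.toGManifold.induceOver L).ref_smul) (by
      rintro M M' j ⟨p⟩
      rfl)

end InduceOver

open SingularGManifold GManifold

/-! ### Fibres and induced manifolds -/

section Fibres

variable {G : Type u} [Group G] [TopologicalSpace G] [DiscreteTopology G] {n : ℕ}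

theorem isoOver_fibre_induceOver [Finite G] {H : Subgroup G} (N : GManifold H n) :
    IsoOver N.toPoint (N.induceOver H).fibre.toPoint := by
  let f : N → (N.induceOver H).fibre := fun x => (N.induceOver H).fibreMk (N.overMk H 1 x) rfl
  refine isoOver_of_bijective (M := N.toPoint) (M' := (N.induceOver H).fibre.toPoint) f
    ⟨?_, ?_⟩ (fun x => ?_) (fun h x => ?_) fun _ => rfl
  · intro x y hxy
    obtain ⟨k, hk, hk'⟩ := overMk_eq_iff.mp (congrArg (N.induceOver H).fibreVal hxy)
    obtain rfl : k = 1 := by simpa using hk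
    exact hk'.symm.trans (one_smul H y)
  · intro q
    obtain ⟨⟨g, x⟩, hp⟩ := exists_overMk ((N.induceOver H).fibreVal q)
    have hg : (g : G ⧸ H) = ((1 : G) : G ⧸ H) := by
      rw [← (N.induceOver H).ref_fibreVal q, ← hp]
      rfl
    have hg' : g ∈ H := by simpa using QuotientGroup.eq.mp hg.symm
    refine ⟨(⟨g, hg'⟩ : H) • x, (N.induceOver H).fibreVal_injective ?_⟩
    rw [← hp]
    exact overMk_eq_iff.mpr ⟨⟨g, hg'⟩, mul_inv_cancel g, rfl⟩
  · exact isLocalDiffeomorphAt_of_comp_left (π := (N.induceOver H).fibreVal)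
      (isLocalDiffeomorph_overMk (1 : G) x) (isLocalDiffeomorph_fibreVal _ _)
      (((N.induceOver H).continuous_fibre_iff (f := f)).mpr
        (isLocalDiffeomorph_overMk (1 : G)).contMDiff.continuous).continuousAt
  · refine (N.induceOver H).fibreVal_injective ?_
    exact overMk_eq_iff.mpr ⟨h, by simp, rfl⟩

/-- A singular manifold over `G/H` is recovered from its fibre by `[g, x] ↦ gx`. -/
theorem isoOver_induceOver_fibre [Finite G] {H : Subgroup G} (M : SingularGManifold G n (G ⧸ H)) :
    IsoOver (M.fibre.induceOver H) M := by
  let f : M.fibre.induceOver H → M := Quotient.lift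
    (fun p : BalancedPre H.subtype M.fibre => p.1 • M.fibreVal p.2) (by
      rintro _ p ⟨k, rfl⟩
      change (p.1 * (k : G)⁻¹) • (k : G) • M.fibreVal p.2 = p.1 • M.fibreVal p.2
      rw [smul_smul, inv_mul_cancel_right])
  have hf : ∀ g x, f (M.fibre.overMk H g x) = g • M.fibreVal x := fun _ _ => rfl
  refine isoOver_of_bijective f ⟨?_, ?_⟩ (fun q => ?_) (fun g q => ?_) (fun q => ?_)
  · intro p q hpq
    obtain ⟨⟨g, x⟩, rfl⟩ := exists_overMk p
    obtain ⟨⟨g', x'⟩, rfl⟩ := exists_overMk q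
    rw [hf, hf] at hpq
    have hg : (g : G ⧸ H) = (g' : G ⧸ H) := by
      have := congrArg M.ref hpq
      rw [M.ref_smul, M.ref_smul, M.ref_fibreVal, M.ref_fibreVal] at this
      simpa [MulAction.Quotient.smul_coe] using this
    have hk := QuotientGroup.eq.mp hg
    refine overMk_eq_iff.mpr ⟨⟨g⁻¹ * g', hk⟩, by simp, M.fibreVal_injective ?_⟩
    rw [M.fibreVal_smul, mul_smul, ← hpq, inv_smul_smul]
  · intro x
    obtain ⟨g, hg⟩ := QuotientGroup.mk_surjective (M.ref x)
    refine ⟨M.fibre.overMk H g (M.fibreMk (g⁻¹ • x) ?_), smul_inv_smul g x⟩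
    rw [M.ref_smul, ← hg, MulAction.Quotient.smul_coe, smul_eq_mul, inv_mul_cancel]
  · obtain ⟨⟨g, x⟩, rfl⟩ := exists_overMk q
    exact isLocalDiffeomorphAt_of_comp_right (f := f)
      (isLocalDiffeomorphAt_comp (f := M.fibreVal) (M.isLocalDiffeomorph_smul g _)
        (M.isLocalDiffeomorph_fibreVal x)) (isLocalDiffeomorph_overMk g x)
  · obtain ⟨⟨g', x⟩, rfl⟩ := exists_overMk q
    exact mul_smul g g' (M.fibreVal x)
  · obtain ⟨⟨g, x⟩, rfl⟩ := exists_overMk q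
    rw [hf, M.ref_smul, M.ref_fibreVal, ref_overMk, MulAction.Quotient.smul_coe, smul_eq_mul,
      mul_one]

/-! ### Fibres of the values of spans -/

variable [Finite G]

/-- The fibre of `M ×_{G/H} G/K` over `eK` is the fibre of `M` over `eH`, with its action restricted
to `K`. -/
theorem isoOver_fibre_span_cosetProj {K H : Subgroup G} (h : K ≤ H)
    (M : SingularGManifold G n (G ⧸ H)) :
    IsoOver (M.span (cosetProj h) (MulActionHom.id G)).fibre.toPoint
      (M.fibre.restrict (Subgroup.inclusion h)).toPoint := by
  let S := M.span (cosetProj h) (MulActionHom.id G)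
  have hS : ∀ q : S.fibre, M.spanSnd _ _ (S.fibreVal q) = ((1 : G) : G ⧸ K) :=
    fun q => S.ref_fibreVal q
  let f : S.fibre → M.fibre := fun q => M.fibreMk (M.spanFst _ _ (S.fibreVal q)) (by
    rw [ref_spanFst, hS]
    rfl)
  have hf : Continuous f := M.continuous_fibre_iff.mpr
    (continuous_spanFst.comp S.isLocalDiffeomorph_fibreVal.contMDiff.continuous)
  refine isoOver_of_bijective (M := S.fibre.toPoint)
    (M' := (M.fibre.restrict (Subgroup.inclusion h)).toPoint) f ⟨?_, ?_⟩ (fun q => ?_)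
    (fun _ _ => rfl) fun _ => rfl
  · intro p q hpq
    exact S.fibreVal_injective (span_ext (congrArg M.fibreVal hpq) ((hS p).trans (hS q).symm))
  · intro x
    exact ⟨S.fibreMk (M.spanMk _ _ (M.fibreVal x) ((1 : G) : G ⧸ K) (M.ref_fibreVal x)) rfl, rfl⟩
  · exact isLocalDiffeomorphAt_of_comp_left (f := f) (π := M.fibreVal)
      (isLocalDiffeomorphAt_comp (f := S.fibreVal) (g := M.spanFst _ _)
        (isLocalDiffeomorph_spanFst _) (S.isLocalDiffeomorph_fibreVal q))
      (M.isLocalDiffeomorph_fibreVal _) hf.continuousAt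

/-- If `M` lies over `G/K`, its fibre over `eH` is `H ×_K N` for the fibre `N` over `eK`, by
`[h, x] ↦ hx`. -/
theorem isoOver_induce_fibre {K H : Subgroup G} (h : K ≤ H)
    (M : SingularGManifold G n (G ⧸ K)) :
    IsoOver (M.fibre.induce (Subgroup.inclusion h) (Subgroup.inclusion_injective h)).toPoint
      (M.span (MulActionHom.id G) (cosetProj h)).fibre.toPoint := by
  let S := M.span (MulActionHom.id G) (cosetProj h)
  let N := M.fibre.induce (Subgroup.inclusion h) (Subgroup.inclusion_injective h)
  let mk : H → M.fibre → N := M.fibre.induceMk (Subgroup.inclusion_injective h)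
  have href : ∀ (a : H) (x : M.fibre), M.ref ((a : G) • M.fibreVal x) = ((a : G) : G ⧸ K) := by
    intro a x
    rw [M.ref_smul, M.ref_fibreVal, MulAction.Quotient.smul_coe, smul_eq_mul, mul_one]
  have hH : ∀ a : H, ((a : G) : G ⧸ H) = ((1 : G) : G ⧸ H) :=
    fun a => QuotientGroup.eq.mpr (by simp)
  let f₀ : H → M.fibre → S.fibre := fun a x =>
    S.fibreMk (M.spanMk _ _ ((a : G) • M.fibreVal x) ((a : G) : G ⧸ K) (href a x)) (hH a)
  have hext : Function.Injective (M.spanFst _ _ ∘ S.fibreVal) :=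
    (spanFst_injective Function.injective_id).comp S.fibreVal_injective
  let f : N → S.fibre := Quotient.lift
    (fun p : BalancedPre (Subgroup.inclusion h) M.fibre => f₀ p.1 p.2) (by
      rintro _ p ⟨k, rfl⟩
      refine hext ?_
      change ((p.1 : G) * (k : G)⁻¹) • (k : G) • M.fibreVal p.2 = (p.1 : G) • M.fibreVal p.2
      rw [smul_smul, inv_mul_cancel_right])
  have hf : ∀ a x, f (mk a x) = f₀ a x := fun _ _ => rfl
  have hpr : IsLocalDiffeomorph (halfI n) (halfI n) ∞
      (M.spanFst (MulActionHom.id G) (cosetProj h) ∘ S.fibreVal) := fun q =>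
    isLocalDiffeomorphAt_comp (f := S.fibreVal) (isLocalDiffeomorph_spanFst _)
      (S.isLocalDiffeomorph_fibreVal q)
  refine isoOver_of_bijective (M := N.toPoint) (M' := S.fibre.toPoint) f ⟨?_, ?_⟩ (fun q => ?_)
    (fun a q => ?_) (fun _ => rfl)
  · intro p q hpq
    obtain ⟨⟨a, x⟩, rfl⟩ := exists_induceMk p
    obtain ⟨⟨b, y⟩, rfl⟩ := exists_induceMk q
    have hxy : (a : G) • M.fibreVal x = (b : G) • M.fibreVal y :=
      congrArg (fun q => M.spanFst _ _ (S.fibreVal q)) hpq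
    have hab : ((a : G) : G ⧸ K) = ((b : G) : G ⧸ K) := by
      rw [← href a x, ← href b y, hxy]
    refine induceMk_eq_iff.mpr ⟨⟨(a : G)⁻¹ * b, QuotientGroup.eq.mp hab⟩, ?_,
      M.fibreVal_injective ?_⟩
    · refine Subtype.ext ?_
      change (b : G) * ((a : G)⁻¹ * b)⁻¹ = a
      simp
    · rw [M.fibreVal_smul, mul_smul, ← hxy, inv_smul_smul]
  · intro q
    obtain ⟨g, hg⟩ := QuotientGroup.mk_surjective (M.spanSnd _ _ (S.fibreVal q))
    have hgH : ((g : G) : G ⧸ H) = ((1 : G) : G ⧸ H) := by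
      have := S.ref_fibreVal q
      rw [ref_span, ← hg] at this
      exact this
    have hgH' : g ∈ H := by simpa using QuotientGroup.eq.mp hgH.symm
    have hq : M.ref (M.spanFst _ _ (S.fibreVal q)) = (g : G ⧸ K) :=
      (ref_spanFst _).trans hg.symm
    refine ⟨mk ⟨g, hgH'⟩ (M.fibreMk (g⁻¹ • M.spanFst _ _ (S.fibreVal q)) ?_),
      hext (smul_inv_smul g _)⟩
    rw [M.ref_smul, hq, MulAction.Quotient.smul_coe, smul_eq_mul, inv_mul_cancel]
  · obtain ⟨⟨a, x⟩, rfl⟩ := exists_induceMk q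
    have hc : IsLocalDiffeomorphAt (halfI n) (halfI n) ∞
        ((M.spanFst (MulActionHom.id G) (cosetProj h) ∘ S.fibreVal) ∘ f₀ a) x :=
      isLocalDiffeomorphAt_comp (f := M.fibreVal) (M.isLocalDiffeomorph_smul (a : G) _)
        (M.isLocalDiffeomorph_fibreVal x)
    have hcont : Continuous (f₀ a) := S.continuous_fibre_iff.mpr (continuous_span
      ((M.contMDiff_smul (a : G)).continuous.comp
        M.isLocalDiffeomorph_fibreVal.contMDiff.continuous) continuous_const)
    exact isLocalDiffeomorphAt_of_comp_right (f := f) (ι := mk a)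
      (isLocalDiffeomorphAt_of_comp_left (f := f₀ a) hc (hpr _) hcont.continuousAt)
      (isLocalDiffeomorph_induceMk a x)
  · obtain ⟨⟨b, x⟩, rfl⟩ := exists_induceMk q
    exact hext (mul_smul (a : G) (b : G) (M.fibreVal x))

/-- The fibre over the trivial coset of `G/gHg⁻¹` is the fibre over `gH`, which is identified by the
action of `g` with the fibre over `eH`. -/
theorem isoOver_restrict_conjHom (g : G) {H : Subgroup G} (M : SingularGManifold G n (G ⧸ H)) :
    IsoOver (M.fibre.restrict (conjHom g H)).toPoint
      (M.span (MulActionHom.id G) (cosetConj g H)).fibre.toPoint := by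
  let S := M.span (MulActionHom.id G) (cosetConj g H)
  have href : ∀ x : M.fibre, M.ref (g • M.fibreVal x) = (g : G ⧸ H) := by
    intro x
    rw [M.ref_smul, M.ref_fibreVal, MulAction.Quotient.smul_coe, smul_eq_mul, mul_one]
  let f : M.fibre → S.fibre := fun x =>
    S.fibreMk (M.spanMk _ _ (g • M.fibreVal x) (g : G ⧸ H) (href x))
      (congrArg QuotientGroup.mk (mul_inv_cancel g))
  have hext : Function.Injective (M.spanFst _ _ ∘ S.fibreVal) :=
    (spanFst_injective Function.injective_id).comp S.fibreVal_injective
  refine isoOver_of_bijective (M := (M.fibre.restrict (conjHom g H)).toPoint)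
    (M' := S.fibre.toPoint) f ⟨?_, ?_⟩ (fun x => ?_) (fun y x => ?_) (fun _ => rfl)
  · intro x y hxy
    exact M.fibreVal_injective (smul_left_cancel g
      (congrArg (fun q => M.spanFst _ _ (S.fibreVal q)) hxy))
  · intro q
    obtain ⟨a, ha⟩ := QuotientGroup.mk_surjective (M.spanSnd _ _ (S.fibreVal q))
    have ha' : ((a * g⁻¹ : G) : G ⧸ conjSubgroup g H) = ((1 : G) : G ⧸ conjSubgroup g H) := by
      have := S.ref_fibreVal q
      rw [ref_span, ← ha] at this
      exact this
    obtain ⟨k, hk, hk'⟩ := QuotientGroup.eq.mp ha'.symm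
    have hga : (g : G ⧸ H) = (a : G ⧸ H) := by
      refine QuotientGroup.eq.mpr ?_
      have : g⁻¹ * a = k := by
        have : g * k * g⁻¹ = a * g⁻¹ := by simpa using hk'
        rw [← mul_right_cancel this, inv_mul_cancel_left]
      rwa [this]
    have hq : M.ref (M.spanFst _ _ (S.fibreVal q)) = (g : G ⧸ H) :=
      (ref_spanFst _).trans (ha.symm.trans hga.symm)
    refine ⟨M.fibreMk (g⁻¹ • M.spanFst _ _ (S.fibreVal q)) ?_, hext (smul_inv_smul g _)⟩
    rw [M.ref_smul, hq, MulAction.Quotient.smul_coe, smul_eq_mul, inv_mul_cancel]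
  · have hc : IsLocalDiffeomorphAt (halfI n) (halfI n) ∞
        ((M.spanFst (MulActionHom.id G) (cosetConj g H) ∘ S.fibreVal) ∘ f) x :=
      isLocalDiffeomorphAt_comp (f := M.fibreVal) (M.isLocalDiffeomorph_smul g _)
        (M.isLocalDiffeomorph_fibreVal x)
    have hcont : Continuous f := S.continuous_fibre_iff.mpr (continuous_span
      ((M.contMDiff_smul g).continuous.comp
        M.isLocalDiffeomorph_fibreVal.contMDiff.continuous) continuous_const)
    exact isLocalDiffeomorphAt_of_comp_left (f := f) hc
      (isLocalDiffeomorphAt_comp (f := S.fibreVal) (isLocalDiffeomorph_spanFst _)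
        (S.isLocalDiffeomorph_fibreVal _)) hcont.continuousAt
  · refine hext ?_
    change g • (g⁻¹ * (y : G) * g) • M.fibreVal x = (y : G) • g • M.fibreVal x
    rw [smul_smul, smul_smul]
    simp [mul_assoc]

end Fibres

/-! ### The identification of `SK^G(G/H)` with `SK^H` -/

section Identification

/-- Every singular manifold in the point is `N.toPoint` for a manifold `N`, so that constructions on
them may be stated in terms of manifolds. -/
theorem existsUnique_hom_point {H K : Type u} [Group H] [Group K] {n : ℕ}
    {Y : Type u} [TopologicalSpace Y] [MulAction K Y]
    {F : SingularGManifold H n PUnit.{u + 1} → SingularGManifold K n Y}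
    (C : LocalConstruction F) :
    ∃! T : SKPoint H n →+ SK K n Y, ∀ N : GManifold H n, T N.cls = (F N.toPoint).cls := by
  obtain ⟨T, hT, hT'⟩ := C.existsUnique_hom
  exact ⟨T, fun N => hT N.toPoint, fun T' h => hT' T' fun M => h M.toGManifold⟩

theorem hom_ext_point {H : Type u} [Group H] {n : ℕ} {A : Type*} [AddCommGroup A]
    {T T' : SKPoint H n →+ A} (h : ∀ N : GManifold H n, T N.cls = T' N.cls) : T = T' :=
  hom_ext_cls fun M => h M.toGManifold

variable {G : Type u} [Group G] [Finite G] [TopologicalSpace G] [DiscreteTopology G] {n : ℕ}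

/-- `SK^G(G/H) ≅ SK^H` by taking fibres, with induction as its inverse. -/
theorem exists_fibreEquiv (H : Subgroup G) : ∃ ι : SK G n (G ⧸ H) ≃+ SKPoint H n,
    (∀ M : SingularGManifold G n (G ⧸ H), ι M.cls = M.fibre.cls) ∧
    ∀ N : GManifold H n, ι.symm N.cls = (N.induceOver H).cls := by
  obtain ⟨a, ha, -⟩ := (fibreConstruction (n := n) H).existsUnique_hom
  obtain ⟨b, hb, -⟩ := existsUnique_hom_point (induceOverConstruction (n := n) H)
  have hba : b.comp a = AddMonoidHom.id _ := hom_ext_cls fun M =>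
    (congrArg b (ha M)).trans ((hb M.fibre).trans (cls_eq_of_isoOver (isoOver_induceOver_fibre M)))
  have hab : a.comp b = AddMonoidHom.id _ := hom_ext_point fun N =>
    (congrArg a (hb N)).trans ((ha _).trans
      (cls_eq_of_isoOver (isoOver_fibre_induceOver N)).symm)
  exact ⟨a.toAddEquiv b hba hab, ha, hb⟩

end Identification

end EquivariantSK

open EquivariantSK in
theorem mainTheorem2 (G : Type u) [Group G] [Finite G] [TopologicalSpace G] [DiscreteTopology G]
    (n : ℕ) :
    -- the values of the Mackey functor on spans and the geometric maps are well defined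
    (∀ (X U Y : Type u) [TopologicalSpace X] [DiscreteTopology X] [Finite X] [MulAction G X]
      [TopologicalSpace U] [DiscreteTopology U] [Finite U] [MulAction G U]
      [TopologicalSpace Y] [DiscreteTopology Y] [Finite Y] [MulAction G Y]
      (α : U →[G] X) (β : U →[G] Y), ∃! T : SK G n X →+ SK G n Y, IsSpanMap α β T) ∧
    (∀ (K H : Subgroup G) (h : K ≤ H),
      (∃! r : SKPoint H n →+ SKPoint K n, IsRestriction h r) ∧
      (∃! t : SKPoint K n →+ SKPoint H n, IsInduction h t)) ∧
    (∀ (g : G) (H : Subgroup G),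
      ∃! c : SKPoint H n →+ SKPoint (conjSubgroup g H) n, IsConjugation g H c) ∧
    -- the identification of `SK^G(G/H)` with `SK^H`
    ∃ ι : ∀ H : Subgroup G, SK G n (G ⧸ H) ≃+ SKPoint H n,
      (∀ (H : Subgroup G) (M : SingularGManifold G n (G ⧸ H)), ι H M.cls = M.fibre.cls) ∧
      (∀ (H : Subgroup G) (N : GManifold H n), (ι H).symm N.cls = (N.induceOver H).cls) ∧
      -- restriction, from the span `G/H ← G/K = G/K`
      (∀ (K H : Subgroup G) (h : K ≤ H) (res : SK G n (G ⧸ H) →+ SK G n (G ⧸ K))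
        (r : SKPoint H n →+ SKPoint K n),
        IsSpanMap (cosetProj h) (MulActionHom.id G) res → IsRestriction h r →
        ∀ x, ι K (res x) = r (ι H x)) ∧
      -- transfer, from the span `G/K = G/K → G/H`
      (∀ (K H : Subgroup G) (h : K ≤ H) (tr : SK G n (G ⧸ K) →+ SK G n (G ⧸ H))
        (t : SKPoint K n →+ SKPoint H n),
        IsSpanMap (MulActionHom.id G) (cosetProj h) tr → IsInduction h t →
        ∀ x, ι H (tr x) = t (ι K x)) ∧
      -- conjugation, from the span `G/H = G/H ≅ G/gHg⁻¹`
      (∀ (g : G) (H : Subgroup G) (cg : SK G n (G ⧸ H) →+ SK G n (G ⧸ conjSubgroup g H))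
        (c : SKPoint H n →+ SKPoint (conjSubgroup g H) n),
        IsSpanMap (MulActionHom.id G) (cosetConj g H) cg → IsConjugation g H c →
        ∀ x, ι (conjSubgroup g H) (cg x) = c (ι H x)) := by
  choose ι hι hι' using fun H : Subgroup G => exists_fibreEquiv (n := n) H
  refine ⟨fun X U Y _ _ _ _ _ _ _ _ _ _ _ _ α β => (spanConstruction α β).existsUnique_hom,
    fun K H h => ⟨existsUnique_hom_point (restrictConstruction _),
      existsUnique_hom_point (induceConstruction (Subgroup.inclusion_injective h))⟩,
    fun g H => existsUnique_hom_point (restrictConstruction _), ι, hι, hι', ?_, ?_, ?_⟩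
  · intro K H h res r hres hr x
    refine DFunLike.congr_fun (f := (ι K).toAddMonoidHom.comp res)
      (g := r.comp (ι H).toAddMonoidHom) (hom_ext_cls fun M => ?_) x
    change ι K (res M.cls) = r (ι H M.cls)
    rw [hres, hι, hι, hr]
    exact cls_eq_of_isoOver (isoOver_fibre_span_cosetProj h M)
  · intro K H h tr t htr ht x
    refine DFunLike.congr_fun (f := (ι H).toAddMonoidHom.comp tr)
      (g := t.comp (ι K).toAddMonoidHom) (hom_ext_cls fun M => ?_) x
    change ι H (tr M.cls) = t (ι K M.cls)
    rw [htr, hι, hι, ht]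
    exact (cls_eq_of_isoOver (isoOver_induce_fibre h M)).symm
  · intro g H cg c hcg hc x
    refine DFunLike.congr_fun (f := (ι (conjSubgroup g H)).toAddMonoidHom.comp cg)
      (g := c.comp (ι H).toAddMonoidHom) (hom_ext_cls fun M => ?_) x
    change ι (conjSubgroup g H) (cg M.cls) = c (ι H M.cls)
    rw [hcg, hι, hι, hc]
    exact (cls_eq_of_isoOver (isoOver_restrict_conjHom g M)).symm
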